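/- Let $n\in\mathbb N$, let $\mathbb F_n^+$ be the free semigroup on $g_1,\dots,g_n$ with identity $g_0$, and let $F^2(H_n)$ be the full Fock space with orthonormal basis $\{e_\alpha\}_{\alpha\in\mathbb F_n^+}$ and $e_{g_0}=1$. Let $\boldsymbol\mu=\{\mu_\beta\}_{|\beta|\ge1}$ be strictly positive numbers, and put $\boldsymbol\mu(g_0,g_0)=1$ and $\boldsymbol\mu(g_i\alpha,g_0)=\mu_{g_i\alpha}\,\boldsymbol\mu(\alpha,g_0)$. Assume that, for each $i$, $$\sup_{\alpha}\mu_{g_i\alpha}<\infty,\qquad \sup_\alpha \frac{\boldsymbol\mu(\alpha g_i,g_0)}{\boldsymbol\mu(\alpha,g_0)}<\infty .$$ Let $W_ie_\alpha=\mu_{g_i\alpha}e_{g_i\alpha}$ be the weighted left shifts. For $\lambda\in\mathbb C^n$ write $\lambda_\alpha=\lambda_{i_1}\cdots\lambda_{i_p}$ if $\alpha=g_{i_1}\cdots g_{i_p}$, $\lambda_{g_0}=1$. Let $\mathcal D(\boldsymbol\mu)$ be the set of all $\lambda\in\mathbb C^n$ for which evaluation at $\lambda$, $p=\sum c_\alpha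 Z_\alpha\mapsto\sum c_\alpha\lambda_\alpha$, is bounded on the polynomials in noncommuting indeterminates $Z_1,\dots,Z_n$ with respect to the norm $\|p\|^2=\sum_\alpha\boldsymbol\mu(\alpha,g_0)^2|c_\alpha|^2$. Assume that $\mathcal D(\boldsymbol\mu)$ contains a neighbourhood of $0$. For $\mathbf k\in\mathbb N_0^n$ let $\Lambda_{\mathbf k}$ be the set of words $\alpha$ with $\lambda_\alpha=\lambda^{\mathbf k}$ for all $\lambda\in\mathbb C^n$, and put $$\omega_{\mathbf k}=\sum_{\alpha\in\Lambda_{\mathbf k}}\frac1{\boldsymbol\mu(\alpha,g_0)^2},\qquad y^{(\mathbf k)}=\frac1{\omega_{\mathbf k}}\sum_{\alpha\in\Lambda_{\mathbf k}}\frac1{\boldsymbol\mu(\alpha,g_0)}e_\alpha .$$ Let $F_s^2(\boldsymbol\mu)$ be the closed span of the vectors $y^{(\mathbf k)}$ in $F^2(H_n)$, let $B_i=P_{F_s^2(\boldsymbol\mu)}W_i|_{F_s^2(\boldsymbol\mu)}$ and $B^{\mathbf k}=B_1^{k_1}\cdots B_n^{k_n}$, and let $F_s^\infty(\boldsymbol\mu)$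 be the $w^*$-closed (non-self-adjoint) subalgebra of $B(F_s^2(\boldsymbol\mu))$ generated by $B_1,\dots,B_n$ and the identity. Let $\mathbb H^2(\mathcal D(\boldsymbol\mu))$ be the reproducing kernel Hilbert space of all functions $\varphi(\lambda)=\sum_{\mathbf k}c_{\mathbf k}\lambda^{\mathbf k}$ on $\mathcal D(\boldsymbol\mu)$ with $\|\varphi\|^2=\sum_{\mathbf k}|c_{\mathbf k}|^2/\omega_{\mathbf k}<\infty$. Let $\mathcal M$ be its multiplier algebra, i.e. the algebra of all functions $\varphi:\mathcal D(\boldsymbol\mu)\to\mathbb C$ with $\varphi\,\mathbb H^2(\mathcal D(\boldsymbol\mu))\subset\mathbb H^2(\mathcal D(\boldsymbol\mu))$, where $M_\varphi f=\varphi f$ and $\varphi$ has the multiplier norm $\|M_\varphi\|$. A formal series $\sum_{\mathbf k}c_{\mathbf k}B^{\mathbf k}$ is called the Fourier representation of $A\in B(F_s^2(\boldsymbol\mu))$ if $A1=\sum_{\mathbf k}c_{\mathbf k}y^{(\mathbf k)}$. Then there are a unitary operator $U:F_s^2(\boldsymbol\mu)\to\mathbb H^2(\mathcal D(\boldsymbol\mu))$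 with $Uy^{(\mathbf k)}=\lambda^{\mathbf k}$ for all $\mathbf k\in\mathbb N_0^n$, and an isometric algebra isomorphism $\Psi$ of $F_s^\infty(\boldsymbol\mu)$ onto $\mathcal M$, such that $UAU^*=M_{\Psi(A)}$ for all $A\in F_s^\infty(\boldsymbol\mu)$, and $\Psi(B_i)$ is the coordinate function $\lambda_i$ for each $i$. Moreover, each $A\in F_s^\infty(\boldsymbol\mu)$ has a unique Fourier representation $\sum_{\mathbf k}c_{\mathbf k}B^{\mathbf k}$, and is uniquely determined by it. It satisfies $Ay^{(\mathbf p)}=\sum_{\mathbf k}c_{\mathbf k}B^{\mathbf k}y^{(\mathbf p)}$ for all $\mathbf p\in\mathbb N_0^n$ and $\Psi(A)(\lambda)=\sum_{\mathbf k}c_{\mathbf k}\lambda^{\mathbf k}$ for all $\lambda\in\mathcal D(\boldsymbol\mu)$, and $$A=\text{SOT-}\lim_{N\to\infty}\sum_{\mathbf k\in\mathbb N_0^n,\ |\mathbf k|\le N}\Bigl(1-\frac{|\mathbf k|}{N+1}\Bigr)c_{\mathbf k}B^{\mathbf k}.$$ -/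

import Mathlib

open scoped Topology ENNReal InnerProductSpace

noncomputable section

namespace WeightedFock

/-! ### Words, weights and the weighted left multi-shift

The free semigroup on generators `g_1, …, g_n` is modelled by `List (Fin n)`: the identity `g_0`
is `[]`, and `g_i α` is `i :: α`. -/

/-- `𝛍(α, g_0) = μ_{g_{i_1} ⋯ g_{i_p}} μ_{g_{i_2} ⋯ g_{i_p}} ⋯ μ_{g_{i_p}}` for
`α = g_{i_1} ⋯ g_{i_p}`, and `𝛍(g_0, g_0) = 1`. -/
def weightProd {n : ℕ} (μ : List (Fin n) → ℝ) : List (Fin n) → ℝ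
  | [] => 1
  | i :: α => μ (i :: α) * weightProd μ α

/-- Weight sequences `{μ_β}_{|β| ≥ 1}` of strictly positive numbers for which the left and the
right multiplications by the indeterminates are bounded. The value at the empty word is never
used. -/
structure WeightSequence (n : ℕ) where
  /-- the weights -/
  toFun : List (Fin n) → ℝ
  pos : ∀ i α, 0 < toFun (i :: α)
  bddAbove_left : ∀ i, BddAbove (Set.range fun α => toFun (i :: α))
  bddAbove_right : ∀ i, BddAbove
    (Set.range fun α => weightProd toFun (α ++ [i]) / weightProd toFun α)

/-- The full Fock space `F²(H_n)`, realized on its orthonormal basis `e_α`. -/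
abbrev Fock (n : ℕ) : Type := lp (fun _ : List (Fin n) => ℂ) 2

/-- The basis vector `e_α`. -/
def e {n : ℕ} (α : List (Fin n)) : Fock n := lp.single 2 α 1

/-- The left creation operator, `S_i e_α = e_{g_i α}`. -/
def creation {n : ℕ} (i : Fin n) : Fock n →L[ℂ] Fock n :=
  LinearMap.mkContinuous
    { toFun := fun f => ⟨Function.extend (List.cons i) f 0, by
        have hi : Function.Injective (List.cons i) := List.cons_injective
        refine memℓp_gen ?_
        rw [← hi.summable_iff]
        · simpa [Function.comp_def, hi.extend_apply] using (lp.memℓp f).summable (by simp)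
        · intro β hβ
          rw [Function.extend_apply' _ _ _ (by simpa using hβ)]
          simp⟩
      map_add' := fun f g => by
        have hi : Function.Injective (List.cons i) := List.cons_injective
        ext β
        change Function.extend (List.cons i) (fun α => f α + g α) 0 β =
          Function.extend (List.cons i) f 0 β + Function.extend (List.cons i) g 0 β
        by_cases h : ∃ α, i :: α = β
        · obtain ⟨α, rfl⟩ := h
          simp only [hi.extend_apply]
        · simp [Function.extend_apply' _ _ _ h]
      map_smul' := fun c f => by
        have hi : Function.Injective (List.cons i) := List.cons_injective
        ext β
        change Function.extend (List.cons i) (fun α => c * f α) 0 β =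
          c * Function.extend (List.cons i) f 0 β
        by_cases h : ∃ α, i :: α = β
        · obtain ⟨α, rfl⟩ := h
          simp only [hi.extend_apply]
        · simp [Function.extend_apply' _ _ _ h] } 1 (fun f => by
      have hi : Function.Injective (List.cons i) := List.cons_injective
      rw [one_mul]
      refine lp.norm_le_of_tsum_le (by simp) (norm_nonneg _) ?_
      rw [lp.norm_rpow_eq_tsum (by simp) f, ← hi.tsum_eq]
      · simp
      · intro β hβ
        by_contra h
        apply hβ
        simp [Function.extend_apply' _ _ _ (by simpa using h)])

theorem creation_e {n : ℕ} (i : Fin n) (α : List (Fin n)) : creation i (e α) = e (i :: α) := by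
  have hi : Function.Injective (List.cons i) := List.cons_injective
  ext β
  change Function.extend (List.cons i) (e α) 0 β = _
  by_cases h : ∃ γ, i :: γ = β
  · obtain ⟨γ, rfl⟩ := h
    rw [hi.extend_apply]
    by_cases hγ : γ = α
    · subst hγ; simp [e]
    · simp [e, lp.single_apply, hγ]
  · rw [Function.extend_apply' _ _ _ h]
    have : β ≠ i :: α := fun hh => h ⟨α, hh.symm⟩
    simp [e, lp.single_apply, this]

namespace WeightSequence

variable {n : ℕ} (μ : WeightSequence n)

/-- `𝛍(α, g_0)`. -/
abbrev prod (α : List (Fin n)) : ℝ := weightProd μ.toFun α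

theorem prod_pos (α : List (Fin n)) : 0 < μ.prod α := by
  induction α with
  | nil => simp [prod, weightProd]
  | cons i α ih => exact mul_pos (μ.pos i α) ih

/-- The diagonal operator, `D_i e_α = μ_{g_i α} e_α`. -/
def diag (i : Fin n) : Fock n →L[ℂ] Fock n :=
  LinearMap.mkContinuousOfExistsBound
    { toFun := fun f => ⟨fun α => (μ.toFun (i :: α) : ℂ) * f α, by
        obtain ⟨M, hM⟩ := μ.bddAbove_left i
        refine Memℓp.mono (g := fun α => M * ‖f α‖) ?_ ?_
        · have := ((lp.memℓp f).norm).const_mul M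
          simpa using this
        · intro α
          have h1 : μ.toFun (i :: α) ≤ M := hM ⟨α, rfl⟩
          have h2 := (μ.pos i α).le
          simp only [norm_mul, Complex.norm_real, Real.norm_eq_abs, abs_of_nonneg h2]
          gcongr⟩
      map_add' := fun f g => by ext α; exact mul_add _ _ _
      map_smul' := fun c f => by ext α; simp; ring }
    (by
      obtain ⟨M, hM⟩ := μ.bddAbove_left i
      have hM0 : 0 ≤ M := (μ.pos i []).le.trans (hM ⟨[], rfl⟩)
      refine ⟨M, fun f => ?_⟩
      have h : M * ‖f‖ = ‖(M : ℂ) • f‖ := by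
        rw [norm_smul, Complex.norm_real, Real.norm_of_nonneg hM0]
      rw [h]
      refine lp.norm_mono (by simp) fun α => ?_
      have h1 : μ.toFun (i :: α) ≤ M := hM ⟨α, rfl⟩
      have h2 := (μ.pos i α).le
      simp only [LinearMap.coe_mk, AddHom.coe_mk, lp.coeFn_smul, Pi.smul_apply, smul_eq_mul,
        norm_mul, Complex.norm_real, Real.norm_of_nonneg h2, Real.norm_of_nonneg hM0]
      gcongr)

theorem diag_e (i : Fin n) (α : List (Fin n)) :
    μ.diag i (e α) = (μ.toFun (i :: α) : ℂ) • e α := by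
  ext β
  change (μ.toFun (i :: β) : ℂ) * (e α : Fock n) β = (μ.toFun (i :: α) : ℂ) * (e α : Fock n) β
  by_cases h : β = α
  · rw [h]
  · simp [e, lp.single_apply, h]

/-- The weighted left creation operators `W_i = S_i D_i`. -/
def W (i : Fin n) : Fock n →L[ℂ] Fock n := creation i ∘L μ.diag i

theorem W_e (i : Fin n) (α : List (Fin n)) :
    μ.W i (e α) = (μ.toFun (i :: α) : ℂ) • e (i :: α) := by
  simp only [W, ContinuousLinearMap.comp_apply, diag_e, map_smul, creation_e]

end WeightSequence

/-! ### Monomials and the sets `Λ_k` -/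

/-- `λ_α = λ_{j_1} ⋯ λ_{j_m}` for `α = g_{j_1} ⋯ g_{j_m}`. -/
def evalWord {n : ℕ} (z : Fin n → ℂ) (α : List (Fin n)) : ℂ := (α.map z).prod

/-- `λ^k = λ_1^{k_1} ⋯ λ_n^{k_n}`. -/
def monomial {n : ℕ} (z : Fin n → ℂ) (k : Fin n → ℕ) : ℂ := ∏ i, z i ^ k i

theorem evalWord_eq {n : ℕ} (z : Fin n → ℂ) (α : List (Fin n)) :
    evalWord z α = monomial z (fun i => α.count i) := by
  simp only [evalWord, monomial]
  rw [Finset.prod_list_map_count]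
  refine Finset.prod_subset (Finset.subset_univ _) fun i _ hi => ?_
  rw [List.count_eq_zero_of_not_mem (by simpa using hi), pow_zero]

theorem monomial_injective {n : ℕ} {k l : Fin n → ℕ}
    (h : ∀ z : Fin n → ℂ, monomial z k = monomial z l) : k = l := by
  ext i
  have := h (Function.update 1 i 2)
  simp only [monomial] at this
  rw [Finset.prod_eq_single i (by intro j _ hj; simp [hj]) (by simp),
    Finset.prod_eq_single i (by intro j _ hj; simp [hj]) (by simp)] at this
  simp only [Function.update_self] at this
  have h2 : (2 : ℕ) ^ k i = 2 ^ l i := by exact_mod_cast this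
  exact Nat.pow_right_injective le_rfl h2

/-- `Λ_k`, the words `α` with `λ_α = λ^k` for all `λ ∈ ℂ^n`. -/
def Lam {n : ℕ} (k : Fin n → ℕ) : Set (List (Fin n)) :=
  {α | ∀ z : Fin n → ℂ, evalWord z α = monomial z k}

theorem mem_Lam {n : ℕ} {k : Fin n → ℕ} {α : List (Fin n)} :
    α ∈ Lam k ↔ (fun i => α.count i) = k := by
  constructor
  · intro h
    exact monomial_injective fun z => by rw [← evalWord_eq, h z]
  · rintro rfl z
    exact evalWord_eq z α

theorem finite_Lam {n : ℕ} (k : Fin n → ℕ) : (Lam k).Finite := by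
  refine (List.finite_length_eq (Fin n) (∑ i, k i)).subset fun α hα => ?_
  rw [mem_Lam] at hα
  subst hα
  have := Multiset.sum_count_eq_card (s := Finset.univ) (m := (α : Multiset (Fin n))) (by simp)
  simpa using this.symm

/-- `Λ_k` as a finite set. -/
def LamFinset {n : ℕ} (k : Fin n → ℕ) : Finset (List (Fin n)) := (finite_Lam k).toFinset

theorem mem_LamFinset {n : ℕ} {k : Fin n → ℕ} {α : List (Fin n)} :
    α ∈ LamFinset k ↔ (fun i => α.count i) = k := by
  simp [LamFinset, mem_Lam]

theorem LamFinset_nonempty {n : ℕ} (k : Fin n → ℕ) : (LamFinset k).Nonempty := by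
  refine ⟨(∑ i, k i • ({i} : Multiset (Fin n))).toList, ?_⟩
  rw [mem_LamFinset]
  ext j
  rw [← Multiset.coe_count, Multiset.coe_toList, Multiset.count_sum']
  simp [Multiset.count_singleton]

theorem LamFinset_zero {n : ℕ} : LamFinset (0 : Fin n → ℕ) = {[]} := by
  ext α
  rw [mem_LamFinset, Finset.mem_singleton]
  constructor
  · intro h
    refine List.eq_nil_iff_forall_not_mem.2 fun i hi => ?_
    have := congrFun h i
    simp only [Pi.zero_apply, List.count_eq_zero] at this
    exact this hi
  · rintro rfl
    ext
    simp

namespace WeightSequence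

variable {n : ℕ} (μ : WeightSequence n)

/-! ### The symmetric weighted Fock space and the compressions -/

/-- `ω_k = ∑_{α ∈ Λ_k} 1 / 𝛍(α, g_0)²`. -/
def ω (k : Fin n → ℕ) : ℝ := ∑ α ∈ LamFinset k, 1 / μ.prod α ^ 2

theorem ω_pos (k : Fin n → ℕ) : 0 < μ.ω k :=
  Finset.sum_pos (fun α _ => by have := μ.prod_pos α; positivity) (LamFinset_nonempty k)

/-- `y^{(k)} = ω_k⁻¹ ∑_{α ∈ Λ_k} 𝛍(α, g_0)⁻¹ e_α`, as a vector of the full Fock space. -/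
def yFock (k : Fin n → ℕ) : Fock n :=
  (1 / μ.ω k : ℂ) • ∑ α ∈ LamFinset k, (1 / μ.prod α : ℂ) • e α

/-- The symmetric weighted Fock space `F_s²(𝛍)`. -/
def symFock : Submodule ℂ (Fock n) :=
  (Submodule.span ℂ (Set.range μ.yFock)).topologicalClosure

instance : CompleteSpace μ.symFock :=
  inferInstanceAs
    (CompleteSpace (Submodule.span ℂ (Set.range μ.yFock)).topologicalClosure)

/-- `y^{(k)}` as a vector of `F_s²(𝛍)`. -/
def y (k : Fin n → ℕ) : μ.symFock :=
  ⟨μ.yFock k, Submodule.le_topologicalClosure _ (Submodule.subset_span ⟨k, rfl⟩)⟩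

/-- The vacuum vector `1 = e_{g_0}` is `y^{(0)}`. -/
theorem y_zero : (μ.y 0 : Fock n) = e [] := by
  simp [y, yFock, ω, LamFinset_zero, weightProd]

/-- `B_i = P_{F_s²(𝛍)} W_i |_{F_s²(𝛍)}`. -/
def B (i : Fin n) : μ.symFock →L[ℂ] μ.symFock :=
  μ.symFock.orthogonalProjectionOnto ∘L μ.W i ∘L μ.symFock.subtypeL

/-- `B^k = B_1^{k_1} ⋯ B_n^{k_n}`. -/
def Bpow (k : Fin n → ℕ) : μ.symFock →L[ℂ] μ.symFock :=
  ((List.finRange n).map fun i => μ.B i ^ k i).prod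

end WeightSequence

/-- The ultraweak (`w*`) topology of `B(H)`: the coarsest topology for which the functionals
`T ↦ ∑_j ⟨T x_j, y_j⟩` are continuous, for all square summable sequences `(x_j)`, `(y_j)`. -/
@[reducible] def ultraweakTopology (H : Type*) [NormedAddCommGroup H] [InnerProductSpace ℂ H] :
    TopologicalSpace (H →L[ℂ] H) :=
  ⨅ (x : lp (fun _ : ℕ => H) 2) (y : lp (fun _ : ℕ => H) 2),
    TopologicalSpace.induced (fun T => ∑' j, ⟪y j, T (x j)⟫_ℂ) inferInstance

namespace WeightSequence

variable {n : ℕ} (μ : WeightSequence n)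

/-- The Hardy algebra `F_s^∞(𝛍)`: the `w*`-closed algebra generated by `B_1, …, B_n` and the
identity. -/
def hardyAlgebra : Subalgebra ℂ (μ.symFock →L[ℂ] μ.symFock) :=
  sInf {A | (∀ i, μ.B i ∈ A) ∧
    IsClosed[ultraweakTopology μ.symFock] (A : Set (μ.symFock →L[ℂ] μ.symFock))}

theorem B_mem (i : Fin n) : μ.B i ∈ μ.hardyAlgebra :=
  Algebra.mem_sInf.2 fun _ hA => hA.1 i

/-! ### The domain `D(𝛍)` and the function space `H²(D(𝛍))` -/

/-- `D(𝛍)`: the points `λ` such that `p ↦ p(λ)`, on the polynomials `p = ∑ c_α Z_α` in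
noncommuting indeterminates, is bounded for the norm `‖p‖² = ∑ 𝛍(α, g_0)² |c_α|²`. -/
def domain : Set (Fin n → ℂ) :=
  {z | ∃ C : ℝ, ∀ p : List (Fin n) →₀ ℂ,
    ‖p.sum fun α c => c * evalWord z α‖ ≤ C * √(p.sum fun α c => μ.prod α ^ 2 * ‖c‖ ^ 2)}

theorem norm_sum_le {z : Fin n → ℂ} {C : ℝ} (hC : ∀ p : List (Fin n) →₀ ℂ,
    ‖p.sum fun α c => c * evalWord z α‖ ≤ C * √(p.sum fun α c => μ.prod α ^ 2 * ‖c‖ ^ 2))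
    (c : (Fin n → ℕ) → ℂ) (K : Finset (Fin n → ℕ)) :
    ‖∑ k ∈ K, c k * monomial z k‖ ≤ C * √(∑ k ∈ K, ‖c k‖ ^ 2 / μ.ω k) := by
  have hdisj : (K : Set (Fin n → ℕ)).PairwiseDisjoint LamFinset := by
    intro k _ l _ hkl
    refine Finset.disjoint_left.2 fun α h1 h2 => hkl ?_
    rw [← mem_LamFinset.1 h1, ← mem_LamFinset.1 h2]
  let f : List (Fin n) → ℂ := fun α => if α ∈ K.biUnion LamFinset then
    c (fun i => α.count i) / (μ.ω (fun i => α.count i) * μ.prod α ^ 2 : ℝ) else 0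
  have hf : ∀ k ∈ K, ∀ α ∈ LamFinset k, f α = c k / (μ.ω k * μ.prod α ^ 2 : ℝ) := by
    intro k hk α hα
    have h1 : α ∈ K.biUnion LamFinset := Finset.mem_biUnion.2 ⟨k, hk, hα⟩
    have h2 := mem_LamFinset.1 hα
    simp only [f, h1, if_true, h2]
  have key := hC (Finsupp.onFinset (K.biUnion LamFinset) f
    (fun α h => by by_contra h'; exact h (if_neg h')))
  rw [Finsupp.onFinset_sum _ (by simp), Finsupp.onFinset_sum _ (by simp),
    Finset.sum_biUnion hdisj, Finset.sum_biUnion hdisj] at key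
  have e1 : ∀ k ∈ K, ∑ α ∈ LamFinset k, f α * evalWord z α = c k * monomial z k := by
    intro k hk
    have h0 : ((μ.ω k : ℝ) : ℂ) ≠ 0 := by exact_mod_cast (μ.ω_pos k).ne'
    have : ∀ α ∈ LamFinset k, f α * evalWord z α =
        c k * monomial z k / (μ.ω k : ℝ) * ((1 / μ.prod α ^ 2 : ℝ) : ℂ) := by
      intro α hα
      rw [hf k hk α hα, evalWord_eq, mem_LamFinset.1 hα]
      push_cast
      field_simp
    rw [Finset.sum_congr rfl this, ← Finset.mul_sum, ← Complex.ofReal_sum]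
    change _ * ((μ.ω k : ℝ) : ℂ) = _
    field_simp
  have e2 : ∀ k ∈ K, ∑ α ∈ LamFinset k, μ.prod α ^ 2 * ‖f α‖ ^ 2 = ‖c k‖ ^ 2 / μ.ω k := by
    intro k hk
    have h0 := μ.ω_pos k
    have : ∀ α ∈ LamFinset k, μ.prod α ^ 2 * ‖f α‖ ^ 2 =
        ‖c k‖ ^ 2 / μ.ω k ^ 2 * (1 / μ.prod α ^ 2) := by
      intro α hα
      have h3 := μ.prod_pos α
      rw [hf k hk α hα, norm_div, Complex.norm_real, Real.norm_of_nonneg (by positivity)]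
      field_simp
    rw [Finset.sum_congr rfl this, ← Finset.mul_sum]
    change _ * μ.ω k = _
    field_simp
  rwa [Finset.sum_congr rfl e1, Finset.sum_congr rfl e2] at key

/-- `φ(λ) = ∑_k c_k λ^k` on `D(𝛍)` with `∑_k |c_k|² / ω_k < ∞`. -/
def IsPowerSeries (c : (Fin n → ℕ) → ℂ) (φ : μ.domain → ℂ) : Prop :=
  Summable (fun k => ‖c k‖ ^ 2 / μ.ω k) ∧
    ∀ z : μ.domain, HasSum (fun k => c k * monomial z.1 k) (φ z)

theorem IsPowerSeries.add {c d : (Fin n → ℕ) → ℂ} {φ ψ : μ.domain → ℂ}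
    (h : μ.IsPowerSeries c φ) (h' : μ.IsPowerSeries d ψ) :
    μ.IsPowerSeries (c + d) (φ + ψ) := by
  refine ⟨?_, fun z => ?_⟩
  · refine Summable.of_nonneg_of_le (fun k => ?_) (fun k => ?_)
      ((h.1.mul_left 2).add (h'.1.mul_left 2))
    · have := μ.ω_pos k
      positivity
    · have h0 := μ.ω_pos k
      rw [Pi.add_apply, ← mul_div_assoc, ← mul_div_assoc, ← add_div]
      gcongr
      have h1 := norm_add_le (c k) (d k)
      nlinarith [sq_nonneg (‖c k‖ - ‖d k‖), norm_nonneg (c k + d k)]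
  · simpa [add_mul] using (h.2 z).add (h'.2 z)

theorem IsPowerSeries.smul (a : ℂ) {c : (Fin n → ℕ) → ℂ} {φ : μ.domain → ℂ}
    (h : μ.IsPowerSeries c φ) : μ.IsPowerSeries (a • c) (a • φ) := by
  refine ⟨?_, fun z => ?_⟩
  · simpa [mul_pow, mul_div_assoc] using h.1.mul_left (‖a‖ ^ 2)
  · simpa [mul_assoc] using (h.2 z).mul_left a

theorem eq_zero_of_hasSum (hD : μ.domain ∈ 𝓝 0) {c : (Fin n → ℕ) → ℂ}
    (h : ∀ z : μ.domain, HasSum (fun k => c k * monomial z.1 k) 0) : c = 0 := by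
  obtain ⟨r, hr, hrD⟩ := Metric.nhds_basis_closedBall.mem_iff.1 hD
  -- the homogeneous parts vanish on a polydisc
  have hom : ∀ (x : Fin n → ℂ), (∀ i, ‖x i‖ ≤ r) → ∀ m : ℕ,
      ∑ k ∈ Finset.piAntidiag Finset.univ m, c k * monomial x k = 0 := by
    intro x hx
    have hs : ∀ t : ℂ, ‖t‖ ≤ 1 → HasSum (fun m : ℕ =>
        t ^ m * ∑ k ∈ Finset.piAntidiag Finset.univ m, c k * monomial x k) 0 := by
      intro t ht
      have hmem : t • x ∈ μ.domain := hrD (by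
        rw [mem_closedBall_zero_iff, pi_norm_le_iff_of_nonneg hr.le]
        intro i
        rw [Pi.smul_apply, smul_eq_mul, norm_mul]
        nlinarith [hx i, norm_nonneg (x i), norm_nonneg t])
      have h1 := h ⟨t • x, hmem⟩
      have h2 := h1.tsum_fiberwise (fun k => ∑ i, k i)
      refine Eq.mpr (congrArg (fun F : ℕ → ℂ => HasSum F 0) (funext fun m => ?_)) h2
      have hset : (fun k : Fin n → ℕ => ∑ i, k i) ⁻¹' {m} =
          ((Finset.piAntidiag Finset.univ m : Finset (Fin n → ℕ)) : Set (Fin n → ℕ)) := by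
        ext k
        simp
      rw [hset, Finset.tsum_subtype' (Finset.piAntidiag Finset.univ m)
        (fun k => c k * monomial (t • x) k), Finset.mul_sum]
      refine Finset.sum_congr rfl fun k hk => ?_
      have hk' : ∑ i, k i = m := by simpa using hk
      simp only [monomial, Pi.smul_apply, smul_eq_mul, mul_pow, Finset.prod_mul_distrib,
        Finset.prod_pow_eq_pow_sum, hk']
      ring
    have hp : HasFPowerSeriesAt (0 : ℂ → ℂ) (FormalMultilinearSeries.ofScalars ℂ
        (fun m : ℕ => ∑ k ∈ Finset.piAntidiag Finset.univ m, c k * monomial x k)) 0 := by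
      rw [hasFPowerSeriesAt_iff]
      filter_upwards [Metric.closedBall_mem_nhds (0 : ℂ) one_pos] with t ht
      simpa [FormalMultilinearSeries.coeff_ofScalars] using hs t (by simpa using ht)
    intro m
    rw [← FormalMultilinearSeries.coeff_ofScalars (𝕜 := ℂ) (p := fun m : ℕ =>
      ∑ k ∈ Finset.piAntidiag Finset.univ m, c k * monomial x k) (n := m), hp.eq_zero]
    rfl
  funext k
  let m := ∑ i, k i
  let P : MvPolynomial (Fin n) ℂ := ∑ l ∈ Finset.piAntidiag Finset.univ m,
    MvPolynomial.monomial (Finsupp.equivFunOnFinite.symm l) (c l)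
  have hP : P = 0 := by
    refine MvPolynomial.funext_set (fun _ => Metric.closedBall (0 : ℂ) r) (fun _ => ?_) ?_
    · exact infinite_of_mem_nhds (0 : ℂ) (Metric.closedBall_mem_nhds _ hr)
    · intro x hx
      have hx' : ∀ i, ‖x i‖ ≤ r := fun i => by simpa using hx i (Set.mem_univ i)
      have := hom x hx' m
      simp only [P, map_sum, map_zero, MvPolynomial.eval_monomial]
      rw [← this]
      refine Finset.sum_congr rfl fun l _ => ?_
      rw [Finsupp.prod_fintype _ _ (by simp)]
      simp [monomial]
  have hc := congrArg (MvPolynomial.coeff (Finsupp.equivFunOnFinite.symm k)) hP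
  simp only [P, MvPolynomial.coeff_sum, MvPolynomial.coeff_monomial, MvPolynomial.coeff_zero,
    EmbeddingLike.apply_eq_iff_eq, Finset.sum_ite_eq'] at hc
  simpa [m] using hc

theorem IsPowerSeries.unique (hD : μ.domain ∈ 𝓝 0) {c d : (Fin n → ℕ) → ℂ} {φ : μ.domain → ℂ}
    (h : μ.IsPowerSeries c φ) (h' : μ.IsPowerSeries d φ) : c = d := by
  rw [← sub_eq_zero]
  refine μ.eq_zero_of_hasSum hD fun z => ?_
  simpa [sub_mul] using (h.2 z).sub (h'.2 z)

/-- The functions on `D(𝛍)` with a power series representation as above. -/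
def hardySubmodule : Submodule ℂ (μ.domain → ℂ) where
  carrier := {φ | ∃ c, μ.IsPowerSeries c φ}
  add_mem' := by
    rintro φ ψ ⟨c, hc⟩ ⟨d, hd⟩
    exact ⟨c + d, hc.add μ hd⟩
  zero_mem' := ⟨0, by simp [IsPowerSeries, summable_zero, hasSum_zero]⟩
  smul_mem' := by
    rintro a φ ⟨c, hc⟩
    exact ⟨a • c, hc.smul μ a⟩

/-- The space `H²(D(𝛍))` of all functions `φ : D(𝛍) → ℂ` with a representation
`φ(λ) = ∑_k c_k λ^k`, `∑_k |c_k|² / ω_k < ∞`. It is a Hilbert space for the norm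
`‖φ‖² = ∑_k |c_k|² / ω_k`; the coefficients are unique since `D(𝛍)` is a neighbourhood of `0`. -/
def HardySpace (_hD : μ.domain ∈ 𝓝 0) : Type := μ.hardySubmodule

end WeightSequence

namespace HardySpace

variable {n : ℕ} {μ : WeightSequence n} {hD : μ.domain ∈ 𝓝 0}

instance : AddCommGroup (μ.HardySpace hD) := inferInstanceAs (AddCommGroup μ.hardySubmodule)

instance : Module ℂ (μ.HardySpace hD) := inferInstanceAs (Module ℂ μ.hardySubmodule)

/-- The underlying function on `D(𝛍)`. -/
def toFun : μ.HardySpace hD →ₗ[ℂ] (μ.domain → ℂ) := μ.hardySubmodule.subtype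

theorem toFun_injective : Function.Injective (toFun : μ.HardySpace hD →ₗ[ℂ] _) :=
  Subtype.val_injective

/-- The coefficients `c_k` of the power series of `f`. -/
def coeff (f : μ.HardySpace hD) : (Fin n → ℕ) → ℂ := Classical.choose f.2

theorem coeff_spec (f : μ.HardySpace hD) : μ.IsPowerSeries (coeff f) (toFun f) :=
  Classical.choose_spec f.2

theorem coeff_eq {f : μ.HardySpace hD} {c : (Fin n → ℕ) → ℂ}
    (h : μ.IsPowerSeries c (toFun f)) : coeff f = c :=
  (coeff_spec f).unique μ hD h

theorem memℓp_iff {c : (Fin n → ℕ) → ℂ} :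
    Memℓp (fun k => c k / √(μ.ω k)) 2 ↔ Summable (fun k => ‖c k‖ ^ 2 / μ.ω k) := by
  rw [memℓp_gen_iff (by simp)]
  refine summable_congr fun k => ?_
  simp [div_pow, Real.sq_sqrt (μ.ω_pos k).le, abs_of_nonneg (Real.sqrt_nonneg _)]

theorem isPowerSeries_of_summable {c : (Fin n → ℕ) → ℂ}
    (h : Summable (fun k => ‖c k‖ ^ 2 / μ.ω k)) : ∃ φ, μ.IsPowerSeries c φ := by
  have hs : ∀ z : μ.domain, Summable (fun k => c k * monomial z.1 k) := by
    rintro ⟨z, C, hC⟩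
    rw [summable_iff_vanishing_norm]
    intro ε hε
    have hC0 : (0 : ℝ) < |C| + 1 := by positivity
    obtain ⟨s, hs⟩ := summable_iff_vanishing_norm.1 h ((ε / (|C| + 1)) ^ 2) (by positivity)
    refine ⟨s, fun t ht => ?_⟩
    have h1 := hs t ht
    have h2 : 0 ≤ ∑ k ∈ t, ‖c k‖ ^ 2 / μ.ω k :=
      Finset.sum_nonneg fun k _ => by have := μ.ω_pos k; positivity
    rw [Real.norm_of_nonneg h2] at h1
    have h3 : √(∑ k ∈ t, ‖c k‖ ^ 2 / μ.ω k) < ε / (|C| + 1) := by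
      rw [Real.sqrt_lt' (by positivity)]
      exact h1
    calc ‖∑ k ∈ t, c k * monomial z k‖ ≤ C * √(∑ k ∈ t, ‖c k‖ ^ 2 / μ.ω k) :=
          μ.norm_sum_le hC c t
      _ ≤ (|C| + 1) * √(∑ k ∈ t, ‖c k‖ ^ 2 / μ.ω k) := by
          gcongr
          linarith [le_abs_self C]
      _ < (|C| + 1) * (ε / (|C| + 1)) := by gcongr
      _ = ε := by field_simp
  exact ⟨fun z => ∑' k, c k * monomial z.1 k, h, fun z => (hs z).hasSum⟩

/-- The normalized coefficients `c_k / √ω_k` identify `H²(D(𝛍))` with `ℓ²`. -/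
def equivLp : μ.HardySpace hD ≃ₗ[ℂ] lp (fun _ : Fin n → ℕ => ℂ) 2 :=
  LinearEquiv.ofBijective
    { toFun := fun f => ⟨fun k => coeff f k / √(μ.ω k), memℓp_iff.2 (coeff_spec f).1⟩
      map_add' := fun f g => by
        have : coeff (f + g) = coeff f + coeff g := coeff_eq (by
          rw [map_add]
          exact (coeff_spec f).add μ (coeff_spec g))
        ext k
        change coeff (f + g) k / _ = coeff f k / _ + coeff g k / _
        rw [this, Pi.add_apply, add_div]
      map_smul' := fun a f => by
        have : coeff (a • f) = a • coeff f := coeff_eq (by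
          rw [map_smul]
          exact (coeff_spec f).smul μ a)
        ext k
        change coeff (a • f) k / _ = a * (coeff f k / _)
        rw [this, Pi.smul_apply, smul_eq_mul, mul_div_assoc] }
    (by
      have hω : ∀ k, ((√(μ.ω k) : ℝ) : ℂ) ≠ 0 := fun k => by
        exact_mod_cast (Real.sqrt_pos.2 (μ.ω_pos k)).ne'
      constructor
      · intro f g hfg
        have h : coeff f = coeff g := by
          ext k
          have := congrArg (fun v : lp (fun _ : Fin n → ℕ => ℂ) 2 => v k) hfg
          exact (div_left_inj' (hω k)).1 this
        refine toFun_injective (funext fun z => ?_)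
        exact ((coeff_spec f).2 z).unique (h ▸ (coeff_spec g).2 z)
      · intro v
        have hv : (fun k => v k * √(μ.ω k) / √(μ.ω k)) = fun k => v k :=
          funext fun k => mul_div_cancel_right₀ _ (hω k)
        obtain ⟨φ, hφ⟩ := isPowerSeries_of_summable (μ := μ) (c := fun k => v k * √(μ.ω k))
          (memℓp_iff.1 (by rw [hv]; exact lp.memℓp v))
        refine ⟨⟨φ, _, hφ⟩, ?_⟩
        ext k
        change coeff (⟨φ, _, hφ⟩ : μ.HardySpace hD) k / _ = v k
        rw [coeff_eq (hD := hD) (f := ⟨φ, _, hφ⟩) hφ]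
        exact congrFun hv k)

instance : NormedAddCommGroup (μ.HardySpace hD) :=
  NormedAddCommGroup.induced _ _ (equivLp : μ.HardySpace hD ≃ₗ[ℂ] _) equivLp.injective

instance : InnerProductSpace ℂ (μ.HardySpace hD) where
  toNormedSpace := NormedSpace.induced ℂ _ _ (equivLp : μ.HardySpace hD ≃ₗ[ℂ] _)
  inner f g := ⟪equivLp f, equivLp g⟫_ℂ
  norm_sq_eq_re_inner f := norm_sq_eq_re_inner (𝕜 := ℂ) (equivLp f)
  conj_inner_symm f g := inner_conj_symm _ _
  add_left f g h := by rw [map_add, inner_add_left]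
  smul_left f g a := by rw [map_smul, inner_smul_left]

theorem norm_def (f : μ.HardySpace hD) : ‖f‖ = ‖equivLp f‖ := rfl

theorem hasSum_norm_sq (f : μ.HardySpace hD) :
    HasSum (fun k => ‖coeff f k‖ ^ 2 / μ.ω k) (‖f‖ ^ 2) := by
  have := lp.hasSum_norm (by simp) (equivLp f)
  rw [← norm_def] at this
  convert this using 2 with k
  · change _ = ‖coeff f k / _‖ ^ _
    simp [div_pow, Real.sq_sqrt (μ.ω_pos k).le, abs_of_nonneg (Real.sqrt_nonneg _)]
  · simp

instance : CompleteSpace (μ.HardySpace hD) :=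
  (LinearIsometryEquiv.mk equivLp fun _ => rfl :
    μ.HardySpace hD ≃ₗᵢ[ℂ] lp (fun _ : Fin n → ℕ => ℂ) 2).toIsometryEquiv.completeSpace

theorem exists_norm_apply_le (z : μ.domain) :
    ∃ C : ℝ, ∀ f : μ.HardySpace hD, ‖toFun f z‖ ≤ C * ‖f‖ := by
  obtain ⟨z, C, hC⟩ := z
  refine ⟨|C|, fun f => ?_⟩
  refine le_of_tendsto ((coeff_spec f).2 ⟨z, C, hC⟩).norm (Filter.Eventually.of_forall fun K => ?_)
  calc ‖∑ k ∈ K, coeff f k * monomial z k‖ ≤ C * √(∑ k ∈ K, ‖coeff f k‖ ^ 2 / μ.ω k) :=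
        μ.norm_sum_le hC _ K
    _ ≤ |C| * √(‖f‖ ^ 2) := by
        gcongr
        · exact le_abs_self C
        · exact sum_le_hasSum _ (fun k _ => by have := μ.ω_pos k; positivity) (hasSum_norm_sq f)
    _ = |C| * ‖f‖ := by rw [Real.sqrt_sq (norm_nonneg _)]

/-- `H²(D(𝛍))` is a reproducing kernel Hilbert space of functions on `D(𝛍)`. -/
instance : RKHS ℂ (μ.HardySpace hD) μ.domain ℂ where
  coeCLM := ⟨toFun, continuous_pi fun z => by
    obtain ⟨C, hC⟩ := exists_norm_apply_le (hD := hD) z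
    exact (LinearMap.mkContinuous (LinearMap.proj z ∘ₗ toFun) C hC).continuous⟩
  coeCLM_injective := toFun_injective

end HardySpace

/-! ### Multipliers -/

section Multiplier

variable {X : Type*} (H : Type*) [NormedAddCommGroup H] [InnerProductSpace ℂ H] [RKHS ℂ H X ℂ]

/-- The multiplier algebra `M(H)` of a Hilbert function space `H`: the functions `φ` with
`φ f ∈ H` for all `f ∈ H`. -/
def multiplierAlgebra : Subalgebra ℂ (X → ℂ) where
  carrier := {φ | ∀ f : H, ∃ g : H, ∀ x, g x = φ x * f x}
  mul_mem' := by
    intro φ ψ hφ hψ f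
    obtain ⟨g, hg⟩ := hψ f
    obtain ⟨h, hh⟩ := hφ g
    exact ⟨h, fun x => by rw [hh, hg, Pi.mul_apply, mul_assoc]⟩
  add_mem' := by
    intro φ ψ hφ hψ f
    obtain ⟨g, hg⟩ := hφ f
    obtain ⟨h, hh⟩ := hψ f
    exact ⟨g + h, fun x => by simp [hg, hh, add_mul]⟩
  algebraMap_mem' := fun a f => ⟨a • f, fun x => by simp⟩

variable {H}

/-- The element `φ f` of `H`. -/
def mulFun (φ : multiplierAlgebra (X := X) H) (f : H) : H := Classical.choose (φ.2 f)

theorem mulFun_apply (φ : multiplierAlgebra (X := X) H) (f : H) (x : X) :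
    mulFun φ f x = (φ : X → ℂ) x * f x :=
  Classical.choose_spec (φ.2 f) x

/-- The multiplication operator `M_φ f = φ f`; it is bounded by the closed graph theorem. Its
operator norm is the multiplier norm of `φ`. -/
def mulOperator [CompleteSpace H] (φ : multiplierAlgebra (X := X) H) : H →L[ℂ] H :=
  ContinuousLinearMap.ofSeqClosedGraph
    (g := { toFun := mulFun φ
            map_add' := fun f g => RKHS.ext fun x => by
              simp [mulFun_apply, mul_add]
            map_smul' := fun a f => RKHS.ext fun x => by
              simp [mulFun_apply, mul_left_comm] })
    (fun u f g hu hg => RKHS.ext fun x => by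
      have h1 := ((RKHS.continuous_eval (H := H) x).tendsto g).comp hg
      have h2 := (((RKHS.continuous_eval (H := H) x).tendsto f).comp hu).const_mul
        ((φ : X → ℂ) x)
      refine tendsto_nhds_unique h1 ?_
      change Filter.Tendsto _ _ (𝓝 (mulFun φ f x))
      rw [mulFun_apply]
      exact h2.congr fun j => (mulFun_apply φ (u j) x).symm)

theorem mulOperator_apply [CompleteSpace H] (φ : multiplierAlgebra (X := X) H) (f : H) (x : X) :
    mulOperator φ f x = (φ : X → ℂ) x * f x :=
  mulFun_apply φ f x

end Multiplier

/-! ### Fourier representations -/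

namespace WeightSequence

variable {n : ℕ} (μ : WeightSequence n)

/-- `∑_k c_k B^k` is the Fourier representation of `A`: `A 1 = ∑_k c_k y^{(k)}`. -/
def IsFourierRepresentation (A : μ.symFock →L[ℂ] μ.symFock) (c : (Fin n → ℕ) → ℂ) : Prop :=
  HasSum (fun k => c k • μ.y k) (A (μ.y 0))

/-- The Cesàro mean `∑_{|k| ≤ N} (1 - |k| / (N + 1)) c_k B^k`. -/
def cesaro (c : (Fin n → ℕ) → ℂ) (N : ℕ) : μ.symFock →L[ℂ] μ.symFock :=
  ∑ k ∈ (Fintype.piFinset fun _ : Fin n => Finset.range (N + 1)) with ∑ i, k i ≤ N,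
    ((1 - (∑ i, k i : ℕ) / (N + 1 : ℝ) : ℝ) * c k : ℂ) • μ.Bpow k

end WeightSequence

end WeightedFock

end

noncomputable section

namespace WeightedFock

/-! ### Fejér means with respect to a graded orthonormal basis -/

/-! The vectors `y k` are orthogonal with ‖y k‖² = 1/ω_k, and each B_i shifts them: B_i (y k) = y (k
+ e_i) (`inner_y_y`, `B_y`). Matching √ω_k y k with the normalized monomials gives the unitary U
(`toHardy`), which turns B_i into multiplication by λ_i.

Call A a multiplication if (U A f)(z) = (U A 1)(z) (U f)(z) for all f and z. Point evaluations are
bounded, so for fixed f and z this equates two ultraweakly continuous functionals of A. The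
multiplications therefore form a w*-closed algebra containing every B_i, and so contain the Hardy
algebra (`hardyAlgebra_le_multiplicationAlgebra`).

The reverse inclusion is the substantial part. Multiplications commute, so A 1 = ∑ c_k y k
propagates to A (y p) = ∑ c_k y (k + p). In the orthonormal basis, the N-th Cesàro mean thus has the
matrix of A with its (q, p) entry multiplied by (1 - ||q| - |p|| / (N + 1))₊. That is 1/(N + 1)
times the sum of the compressions P_s A P_s to windows of N + 1 consecutive degrees. Each basis
vector lies in exactly N + 1 windows, so Cauchy–Schwarz bounds the mean by ‖A‖
(`norm_le_of_fejerWeight`). Convergence on basis vectors then gives strong convergence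
(`tendsto_of_fejerWeight`), hence ultraweak convergence, and A is a w*-limit of polynomials in the
B_i (`multiplicationAlgebra_le_hardyAlgebra`).

Finally, a multiplier is pulled back along U to a multiplication, so the symbol map A ↦ U A 1 is
onto the multiplier algebra; unitary equivalence makes it isometric. -/

/-- The Fejér weight `(1 - |l - m| / (N + 1))₊`, written as a normalized count of the windows of
length `N + 1` that contain both `m` and `l`. -/
def fejerWeight (N m l : ℕ) : ℝ :=
  (Finset.Icc m (m + N) ∩ Finset.Icc l (l + N)).card / (N + 1)

/-- Two windows whose starting points differ by k overlap in N + 1 - k integers, or in none when k >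
N. The value is independent of m, which lets one scalar coefficient of B^k act as a matrix
multiplier. -/
theorem fejerWeight_add (N m k : ℕ) :
    fejerWeight N m (k + m) = if k ≤ N then 1 - k / (N + 1 : ℝ) else 0 := by
  have h : Finset.Icc m (m + N) ∩ Finset.Icc (k + m) (k + m + N) =
      Finset.Icc (k + m) (m + N) := by
    ext x
    simp only [Finset.mem_inter, Finset.mem_Icc]
    omega
  rw [fejerWeight, h, Nat.card_Icc]
  split_ifs with hk
  · have : m + N + 1 - (k + m) = N + 1 - k := by omega
    rw [this, Nat.cast_sub (by omega)]
    push_cast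
    field_simp
  · have : m + N + 1 - (k + m) = 0 := by omega
    simp [this]

theorem fejerWeight_comm (N m l : ℕ) : fejerWeight N m l = fejerWeight N l m := by
  rw [fejerWeight, fejerWeight, Finset.inter_comm]

theorem fejerWeight_nonneg (N m l : ℕ) : 0 ≤ fejerWeight N m l := by
  unfold fejerWeight
  positivity

theorem fejerWeight_le_one (N m l : ℕ) : fejerWeight N m l ≤ 1 := by
  rw [fejerWeight, div_le_one (by positivity)]
  have h := Finset.card_le_card
    (Finset.inter_subset_left (s₁ := Finset.Icc m (m + N)) (s₂ := Finset.Icc l (l + N)))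
  rw [Nat.card_Icc, show m + N + 1 - m = N + 1 by omega] at h
  exact_mod_cast h

theorem tendsto_fejerWeight (m l : ℕ) :
    Filter.Tendsto (fun N => fejerWeight N m l) Filter.atTop (𝓝 1) := by
  wlog h : m ≤ l generalizing m l
  · simpa only [fejerWeight_comm _ m l] using this l m (le_of_not_ge h)
  obtain ⟨k, rfl⟩ := Nat.exists_eq_add_of_le' h
  have h1 : Filter.Tendsto (fun N : ℕ => 1 - (k : ℝ) / (N + 1 : ℝ)) Filter.atTop (𝓝 (1 - 0)) :=
    ((tendsto_const_div_atTop_nhds_zero_nat (k : ℝ)).comp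
      (Filter.tendsto_add_atTop_nat 1)).const_sub 1 |>.congr fun N => by simp
  rw [sub_zero] at h1
  refine h1.congr' ?_
  filter_upwards [Filter.eventually_ge_atTop k] with N hN
  rw [fejerWeight_add, if_pos hN]

/-! ### Compressions to windows of degrees and their averages -/

section Fejer

variable {ι H : Type*} [NormedAddCommGroup H] [InnerProductSpace ℂ H]
  (b : HilbertBasis ι ℂ H) {d : ι → ℕ} (hd : ∀ m, {k | d k ≤ m}.Finite)

/-- The indices whose degree lies in the window `[s - N, s]`. -/
def window (N s : ℕ) : Finset ι := (hd s).toFinset.filter fun k => s ≤ d k + N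

/-- Read from the side of s: a fixed index k lies in exactly N + 1 windows. -/
theorem mem_window {N s : ℕ} {k : ι} : k ∈ window hd N s ↔ s ∈ Finset.Icc (d k) (d k + N) := by
  simp [window]

/-- The orthogonal projection onto the span of the basis vectors with degree in a window. -/
def windowProj (N s : ℕ) : H →ₗ[ℂ] H :=
  ∑ k ∈ window hd N s, (innerₛₗ ℂ (b k)).smulRight (b k)

theorem windowProj_apply (N s : ℕ) (x : H) :
    windowProj b hd N s x = ∑ k ∈ window hd N s, ⟪b k, x⟫_ℂ • b k := by
  simp [windowProj]

theorem windowProj_basis [DecidableEq ι] (N s : ℕ) (p : ι) :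
    windowProj b hd N s (b p) = if s ∈ Finset.Icc (d p) (d p + N) then b p else 0 := by
  simp only [windowProj_apply, orthonormal_iff_ite.1 b.orthonormal, ite_smul, one_smul, zero_smul,
    Finset.sum_ite_eq', mem_window]

theorem norm_windowProj_sq (N s : ℕ) (x : H) :
    ‖windowProj b hd N s x‖ ^ 2 = ∑ k ∈ window hd N s, ‖⟪b k, x⟫_ℂ‖ ^ 2 := by
  have := b.orthonormal.inner_sum (fun k => ⟪b k, x⟫_ℂ) (fun k => ⟪b k, x⟫_ℂ) (window hd N s)
  rw [windowProj_apply, ← Complex.ofReal_inj, Complex.ofReal_pow]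
  refine (inner_self_eq_norm_sq_to_K (𝕜 := ℂ) _).symm.trans (this.trans ?_)
  push_cast
  exact Finset.sum_congr rfl fun k _ => Complex.conj_mul' _

/-- Exchanging the two sums counts each basis coefficient at most N + 1 times; Bessel's inequality
does the rest. -/
theorem sum_norm_windowProj_sq_le (N M : ℕ) (x : H) :
    ∑ s ∈ Finset.range M, ‖windowProj b hd N s x‖ ^ 2 ≤ (N + 1) * ‖x‖ ^ 2 := by
  classical
  -- One finite index set for all the windows s < M, so that the order of summation can be
  -- exchanged.
  let K := (Finset.range M).biUnion (window hd N)
  have h1 : ∀ s ∈ Finset.range M, ‖windowProj b hd N s x‖ ^ 2 =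
      ∑ k ∈ K, if s ∈ Finset.Icc (d k) (d k + N) then ‖⟪b k, x⟫_ℂ‖ ^ 2 else 0 := by
    intro s hs
    rw [norm_windowProj_sq, ← Finset.sum_filter]
    congr 1
    ext k
    rw [Finset.mem_filter, mem_window]
    exact ⟨fun h => ⟨Finset.mem_biUnion.2 ⟨s, hs, (mem_window hd).2 h⟩, h⟩, fun h => h.2⟩
  rw [Finset.sum_congr rfl h1, Finset.sum_comm]
  calc _ ≤ ∑ k ∈ K, (N + 1) * ‖⟪b k, x⟫_ℂ‖ ^ 2 := by
        refine Finset.sum_le_sum fun k _ => ?_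
        rw [← Finset.sum_filter, Finset.sum_const, nsmul_eq_mul]
        refine mul_le_mul_of_nonneg_right ?_ (by positivity)
        have h2 : (Finset.range M).filter (fun s => s ∈ Finset.Icc (d k) (d k + N)) ⊆
            Finset.Icc (d k) (d k + N) := fun s hs => (Finset.mem_filter.1 hs).2
        have h3 := Finset.card_le_card h2
        rw [Nat.card_Icc, show d k + N + 1 - d k = N + 1 by omega] at h3
        exact_mod_cast h3
    _ ≤ (N + 1) * ‖x‖ ^ 2 := by
        rw [← Finset.mul_sum]
        gcongr
        exact b.orthonormal.sum_inner_products_le x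

variable {N : ℕ} {A C : H →L[ℂ] H}

/-- Both sides are sesquilinear in (g, f), so basis vectors suffice; there the sum counts the
windows containing both indices. The number of windows needed depends on the vectors, and
"eventually in M" survives linear combinations. -/
theorem inner_eq_sum_windowProj
    (h : ∀ p q, ⟪b q, C (b p)⟫_ℂ = fejerWeight N (d p) (d q) * ⟪b q, A (b p)⟫_ℂ)
    {f g : H} (hf : f ∈ Submodule.span ℂ (Set.range b)) (hg : g ∈ Submodule.span ℂ (Set.range b)) :
    ∀ᶠ M in Filter.atTop, (N + 1) * ⟪g, C f⟫_ℂ =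
      ∑ s ∈ Finset.range M, ⟪windowProj b hd N s g, A (windowProj b hd N s f)⟫_ℂ := by
  classical
  induction hg using Submodule.span_induction with
  | zero => simp
  | add g₁ g₂ _ _ h₁ h₂ =>
    filter_upwards [h₁, h₂] with M h₁ h₂
    simp only [map_add, inner_add_left, mul_add, Finset.sum_add_distrib, h₁, h₂]
  | smul a g _ h =>
    filter_upwards [h] with M h
    simp only [map_smul, inner_smul_left, ← Finset.mul_sum, ← h]
    ring
  | mem g hg =>
    obtain ⟨q, rfl⟩ := hg
    induction hf using Submodule.span_induction with
    | zero => simp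
    | add f₁ f₂ _ _ h₁ h₂ =>
      filter_upwards [h₁, h₂] with M h₁ h₂
      simp only [map_add, inner_add_right, mul_add, Finset.sum_add_distrib, h₁, h₂]
    | smul a f _ h =>
      filter_upwards [h] with M h
      simp only [map_smul, inner_smul_right, ← Finset.mul_sum, ← h]
      ring
    | mem f hf =>
      obtain ⟨p, rfl⟩ := hf
      -- No window beyond s = d p + N contains p, so the cutoff at M loses nothing.
      filter_upwards [Filter.eventually_gt_atTop (d p + N)] with M hM
      have h1 : ∀ s ∈ Finset.range M,
          ⟪windowProj b hd N s (b q), A (windowProj b hd N s (b p))⟫_ℂ =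
          if s ∈ Finset.Icc (d p) (d p + N) ∩ Finset.Icc (d q) (d q + N) then
            ⟪b q, A (b p)⟫_ℂ else 0 := by
        intro s _
        simp only [windowProj_basis, Finset.mem_inter]
        split_ifs <;> simp_all
      have h2 : (Finset.range M).filter (fun s => s ∈ Finset.Icc (d p) (d p + N) ∩
          Finset.Icc (d q) (d q + N)) = Finset.Icc (d p) (d p + N) ∩ Finset.Icc (d q) (d q + N) := by
        ext s
        simp only [Finset.mem_filter, Finset.mem_range, Finset.mem_inter, Finset.mem_Icc]
        omega
      rw [Finset.sum_congr rfl h1, ← Finset.sum_filter, h2, Finset.sum_const, nsmul_eq_mul, h,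
        fejerWeight]
      have : (N + 1 : ℂ) ≠ 0 := by exact_mod_cast N.succ_ne_zero
      push_cast
      field_simp

/-- (N + 1)⟨g, C f⟩ is the sum of the ⟨P_s g, A P_s f⟩. Cauchy–Schwarz over s costs √(N + 1) for
each of f and g, exactly cancelling the factor on the left. -/
theorem norm_le_of_fejerWeight (hd : ∀ m, {k | d k ≤ m}.Finite)
    (h : ∀ p q, ⟪b q, C (b p)⟫_ℂ = fejerWeight N (d p) (d q) * ⟪b q, A (b p)⟫_ℂ) :
    ‖C‖ ≤ ‖A‖ := by
  have hdense : Dense (Submodule.span ℂ (Set.range b) : Set H) :=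
    Submodule.dense_iff_topologicalClosure_eq_top.2 b.dense_span
  have h0 : (0 : ℝ) < N + 1 := by positivity
  have key : ∀ f ∈ Submodule.span ℂ (Set.range b), ∀ g ∈ Submodule.span ℂ (Set.range b),
      ‖⟪g, C f⟫_ℂ‖ ≤ ‖A‖ * ‖f‖ * ‖g‖ := by
    intro f hf g hg
    obtain ⟨M, hM⟩ := (inner_eq_sum_windowProj b hd h hf hg).exists
    have h1 := congrArg norm hM
    rw [norm_mul, show ((N : ℂ) + 1) = ((N + 1 : ℝ) : ℂ) by push_cast; rfl, Complex.norm_real,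
      Real.norm_of_nonneg h0.le] at h1
    refine le_of_mul_le_mul_left ?_ h0
    rw [h1]
    calc _ ≤ ∑ s ∈ Finset.range M,
          ‖A‖ * (‖windowProj b hd N s f‖ * ‖windowProj b hd N s g‖) := by
          refine norm_sum_le_of_le _ fun s _ => (norm_inner_le_norm _ _).trans ?_
          have := A.le_opNorm (windowProj b hd N s f)
          calc _ ≤ ‖windowProj b hd N s g‖ * (‖A‖ * ‖windowProj b hd N s f‖) := by gcongr
            _ = _ := by ring
      _ ≤ ‖A‖ * (√((N + 1) * ‖f‖ ^ 2) * √((N + 1) * ‖g‖ ^ 2)) := by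
          rw [← Finset.mul_sum]
          gcongr
          refine (Real.sum_mul_le_sqrt_mul_sqrt _ _ _).trans ?_
          gcongr <;> exact sum_norm_windowProj_sq_le b hd N M _
      _ = _ := by
          rw [Real.sqrt_mul h0.le, Real.sqrt_mul h0.le, Real.sqrt_sq (norm_nonneg _),
            Real.sqrt_sq (norm_nonneg _)]
          linear_combination ‖A‖ * ‖f‖ * ‖g‖ * Real.mul_self_sqrt h0.le
  have key' : ∀ f g, ‖⟪g, C f⟫_ℂ‖ ≤ ‖A‖ * ‖f‖ * ‖g‖ := by
    intro f g
    refine hdense.induction (P := fun f => ‖⟪g, C f⟫_ℂ‖ ≤ ‖A‖ * ‖f‖ * ‖g‖) (fun f hf => ?_)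
      (isClosed_le (by fun_prop) (by fun_prop)) f
    exact hdense.induction (P := fun g => ‖⟪g, C f⟫_ℂ‖ ≤ ‖A‖ * ‖f‖ * ‖g‖) (key f hf)
      (isClosed_le (by fun_prop) (by fun_prop)) g
  -- Test with g = C f and cancel one factor ‖C f‖, treating ‖C f‖ = 0 separately.
  refine C.opNorm_le_bound (norm_nonneg _) fun f => ?_
  rcases (norm_nonneg (C f)).eq_or_lt with h1 | h1
  · rw [← h1]; positivity
  · refine le_of_mul_le_mul_right ?_ h1
    have := key' f (C f)
    rwa [inner_self_eq_norm_sq_to_K, norm_pow, RCLike.norm_ofReal, abs_norm, sq] at this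

/-- The strong limit of a bounded sequence of operators may be computed on a total set. -/
theorem tendsto_apply_of_norm_le {C : ℕ → H →L[ℂ] H} {K : ℝ} (hC : ∀ N, ‖C N‖ ≤ K) {s : Set H}
    (hs : Dense (Submodule.span ℂ s : Set H))
    (h : ∀ x ∈ s, Filter.Tendsto (fun N => C N x) Filter.atTop (𝓝 (A x))) (x : H) :
    Filter.Tendsto (fun N => C N x) Filter.atTop (𝓝 (A x)) := by
  have hspan : ∀ x ∈ Submodule.span ℂ s,
      Filter.Tendsto (fun N => C N x) Filter.atTop (𝓝 (A x)) := by
    intro x hx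
    induction hx using Submodule.span_induction with
    | zero => simp
    | add x y _ _ hx hy => simpa using hx.add hy
    | smul a x _ hx => simpa using hx.const_smul a
    | mem x hx => exact h x hx
  have hK : 0 ≤ K := (norm_nonneg _).trans (hC 0)
  rw [Metric.tendsto_atTop]
  intro ε hε
  -- The approximation error enters through both C N and A, at a cost of at most (K + ‖A‖)‖x - y‖;
  -- the added 1 keeps the denominator positive.
  obtain ⟨y, hy, hxy⟩ := hs.exists_dist_lt x (ε := ε / (2 * (K + ‖A‖ + 1))) (by positivity)
  obtain ⟨N₀, hN₀⟩ := Metric.tendsto_atTop.1 (hspan y hy) (ε / 2) (by positivity)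
  refine ⟨N₀, fun N hN => ?_⟩
  have h1 := hN₀ N hN
  rw [dist_eq_norm] at h1 hxy ⊢
  have h2 : C N x - A x = C N (x - y) + (C N y - A y) - A (x - y) := by
    simp only [map_sub]; abel
  have h3 : ‖C N (x - y)‖ ≤ K * ‖x - y‖ := (C N).le_of_opNorm_le (hC N) _
  have h4 := A.le_opNorm (x - y)
  have h5 : (K + ‖A‖ + 1) * ‖x - y‖ < ε / 2 := by
    rw [lt_div_iff₀ (by positivity)] at hxy
    linarith
  have h6 := (norm_sub_le (C N (x - y) + (C N y - A y)) (A (x - y))).trans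
    (add_le_add_left (norm_add_le (C N (x - y)) (C N y - A y)) _)
  rw [h2]
  nlinarith [norm_nonneg (x - y)]

/-- The Fejér means of a bounded operator, with respect to a graded orthonormal basis, converge
to it strongly. -/
theorem tendsto_of_fejerWeight (hd : ∀ m, {k | d k ≤ m}.Finite) {C : ℕ → H →L[ℂ] H}
    (h : ∀ N p q, ⟪b q, C N (b p)⟫_ℂ = fejerWeight N (d p) (d q) * ⟪b q, A (b p)⟫_ℂ) (x : H) :
    Filter.Tendsto (fun N => C N x) Filter.atTop (𝓝 (A x)) := by
  refine tendsto_apply_of_norm_le (fun N => norm_le_of_fejerWeight b hd (h N))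
    (Submodule.dense_iff_topologicalClosure_eq_top.2 b.dense_span) ?_ x
  rintro _ ⟨p, rfl⟩
  have hsum : ∀ x : H, HasSum (fun q => ‖⟪b q, x⟫_ℂ‖ ^ 2) (‖x‖ ^ 2) := by
    intro x
    have := lp.hasSum_norm (p := 2) (by simp) (b.repr x)
    simpa [b.repr_apply_apply] using this
  rw [tendsto_iff_norm_sub_tendsto_zero]
  -- By Parseval the squared error is a series in q. Each term tends to 0 and is dominated by ‖⟪b q,
  -- A (b p)⟫‖², which is summable.
  have h1 : Filter.Tendsto (fun N => ‖C N (b p) - A (b p)‖ ^ 2) Filter.atTop (𝓝 0) := by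
    have h2 : ∀ N q, ‖⟪b q, C N (b p) - A (b p)⟫_ℂ‖ ^ 2 =
        (1 - fejerWeight N (d p) (d q)) ^ 2 * ‖⟪b q, A (b p)⟫_ℂ‖ ^ 2 := by
      intro N q
      have h3 : ⟪b q, C N (b p) - A (b p)⟫_ℂ =
          ((fejerWeight N (d p) (d q) - 1 : ℝ) : ℂ) * ⟪b q, A (b p)⟫_ℂ := by
        rw [inner_sub_right, h]
        push_cast
        ring
      rw [h3, norm_mul, Complex.norm_real, mul_pow, Real.norm_eq_abs, sq_abs]
      ring
    have h4 := tendsto_tsum_of_dominated_convergence (hsum (A (b p))).summable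
      (f := fun N q => ‖⟪b q, C N (b p) - A (b p)⟫_ℂ‖ ^ 2) (g := fun _ => 0) (𝓕 := Filter.atTop)
      (fun q => by
        have := (((tendsto_fejerWeight (d p) (d q)).const_sub 1).pow 2).mul_const
          (‖⟪b q, A (b p)⟫_ℂ‖ ^ 2)
        simp only [h2]
        simpa using this)
      (Filter.Eventually.of_forall fun N q => by
        have h5 := fejerWeight_nonneg N (d p) (d q)
        have h6 := fejerWeight_le_one N (d p) (d q)
        rw [h2, Real.norm_of_nonneg (by positivity)]
        refine mul_le_of_le_one_left (by positivity) ?_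
        nlinarith)
    simp only [tsum_zero] at h4
    exact h4.congr fun N => (hsum _).tsum_eq
  have h7 := h1.sqrt
  simpa [Real.sqrt_sq (norm_nonneg _)] using h7

end Fejer

/-! ### The ultraweak topology -/

section Ultraweak

variable {H : Type*} [NormedAddCommGroup H] [InnerProductSpace ℂ H]

/-- Strong convergence gives termwise convergence in every defining functional; the uniform norm
bound supplies the summable majorant K(‖x_j‖² + ‖y_j‖²). -/
theorem tendsto_ultraweakTopology {C : ℕ → H →L[ℂ] H} {A : H →L[ℂ] H} {K : ℝ}
    (hC : ∀ N, ‖C N‖ ≤ K) (h : ∀ x, Filter.Tendsto (fun N => C N x) Filter.atTop (𝓝 (A x))) :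
    Filter.Tendsto C Filter.atTop (@nhds _ (ultraweakTopology H) A) := by
  simp only [nhds_iInf, nhds_induced, Filter.tendsto_iInf,
    Filter.tendsto_comap_iff]
  intro x y
  have hx := (lp.memℓp x).summable (by simp)
  have hy := (lp.memℓp y).summable (by simp)
  refine tendsto_tsum_of_dominated_convergence
    (bound := fun j => K * (‖x j‖ ^ 2 + ‖y j‖ ^ 2)) ?_ (fun j => ?_)
    (Filter.Eventually.of_forall fun N j => ?_)
  · exact ((by simpa using hx : Summable fun j => ‖x j‖ ^ 2).add (by simpa using hy)).mul_left K
  · exact Filter.Tendsto.inner tendsto_const_nhds (h (x j))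
  · have hK : 0 ≤ K := (norm_nonneg _).trans (hC 0)
    have h1 := (C N).le_of_opNorm_le (hC N) (x j)
    calc _ ≤ ‖y j‖ * (K * ‖x j‖) := (norm_inner_le_norm _ _).trans (by gcongr)
      _ = K * (‖x j‖ * ‖y j‖) := by ring
      _ ≤ _ := by
        gcongr
        nlinarith [sq_nonneg (‖x j‖ - ‖y j‖), sq_nonneg (‖x j‖), sq_nonneg (‖y j‖)]

/-- This is a defining functional of the topology, for sequences supported at index 0. -/
theorem continuous_ultraweakTopology_inner (x y : H) :
    Continuous[ultraweakTopology H, inferInstance] fun T : H →L[ℂ] H => ⟪y, T x⟫_ℂ := by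
  have h1 : (fun T : H →L[ℂ] H => ⟪y, T x⟫_ℂ) = fun T : H →L[ℂ] H =>
      ∑' j, ⟪(lp.single 2 0 y : lp (fun _ : ℕ => H) 2) j,
        T ((lp.single 2 0 x : lp (fun _ : ℕ => H) 2) j)⟫_ℂ := by
    funext T
    rw [tsum_eq_single 0 (fun j hj => by simp [lp.single_apply, hj])]
    simp
  rw [h1, continuous_iff_le_induced]
  exact (iInf_le _ (lp.single 2 0 x : lp (fun _ : ℕ => H) 2)).trans
    (iInf_le _ (lp.single 2 0 y : lp (fun _ : ℕ => H) 2))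

end Ultraweak

/-! ### The orthogonal basis of the symmetric weighted Fock space -/

theorem inner_e_e {n : ℕ} (α β : List (Fin n)) :
    ⟪(e α : Fock n), e β⟫_ℂ = if α = β then 1 else 0 := by
  rw [e, lp.inner_single_left, e, lp.single_apply, Pi.single_apply]
  split_ifs <;> simp

namespace WeightSequence

variable {n : ℕ} (μ : WeightSequence n)

theorem symFock_inner_smul_left (x z : μ.symFock) (a : ℂ) :
    ⟪a • x, z⟫_ℂ = (starRingEnd ℂ) a * ⟪x, z⟫_ℂ :=
  inner_smul_left (x : Fock n) z a

theorem symFock_inner_smul_right (x z : μ.symFock) (a : ℂ) :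
    ⟪x, a • z⟫_ℂ = a * ⟪x, z⟫_ℂ :=
  inner_smul_right (x : Fock n) z a

theorem inner_yFock_e (l : Fin n → ℕ) (α : List (Fin n)) :
    ⟪μ.yFock l, e α⟫_ℂ =
      if (fun i => α.count i) = l then (1 / (μ.ω l * μ.prod α) : ℂ) else 0 := by
  simp only [yFock, inner_smul_left, sum_inner, inner_e_e, mul_ite, mul_one, mul_zero,
    Finset.sum_ite_eq', mem_LamFinset]
  split_ifs
  · simp
    ring
  · simp

theorem sum_inv_prod_sq (k : Fin n → ℕ) :
    ∑ α ∈ LamFinset k, (1 / μ.prod α ^ 2 : ℂ) = μ.ω k := by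
  simp [ω]

/-- The sets Λ_k are disjoint, giving orthogonality; on the diagonal the sum of 1/𝛍(α, g_0)² is ω_k
and cancels one of the two normalizations. -/
theorem inner_y_y (l k : Fin n → ℕ) :
    ⟪μ.y l, μ.y k⟫_ℂ = if l = k then (1 / μ.ω l : ℂ) else 0 := by
  have hω : (μ.ω k : ℂ) ≠ 0 := by exact_mod_cast (μ.ω_pos k).ne'
  change ⟪μ.yFock l, μ.yFock k⟫_ℂ = _
  rw [show μ.yFock k = (1 / μ.ω k : ℂ) • ∑ α ∈ LamFinset k, (1 / μ.prod α : ℂ) • e α from rfl,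
    inner_smul_right, inner_sum]
  have h : ∀ α ∈ LamFinset k, ⟪μ.yFock l, (1 / μ.prod α : ℂ) • e α⟫_ℂ =
      (if l = k then (1 / μ.ω l : ℂ) else 0) * (1 / μ.prod α ^ 2 : ℂ) := by
    intro α hα
    rw [inner_smul_right, inner_yFock_e, mem_LamFinset.1 hα]
    simp only [eq_comm (a := k)]
    split_ifs
    · ring
    · simp
  rw [Finset.sum_congr rfl h, ← Finset.mul_sum, sum_inv_prod_sq]
  field_simp

theorem count_cons_eq (i : Fin n) (α : List (Fin n)) :
    (fun j => (i :: α).count j) = (fun j => α.count j) + Pi.single i 1 := by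
  ext j
  rw [List.count_cons, Pi.add_apply, Pi.single_apply]
  congr 1
  simp only [beq_iff_eq, eq_comm (a := i)]

/-- The difference is orthogonal to the span of the y's, hence to its closure, in which it lies. -/
theorem eq_of_forall_inner_y {f g : μ.symFock} (h : ∀ k, ⟪μ.y k, f⟫_ℂ = ⟪μ.y k, g⟫_ℂ) :
    f = g := by
  rw [← sub_eq_zero]
  set x := f - g with hx
  have h0 : ∀ k, ⟪μ.yFock k, (x : Fock n)⟫_ℂ = 0 := by
    intro k
    change ⟪μ.y k, x⟫_ℂ = 0
    rw [hx, inner_sub_right, h, sub_self]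
  have h1 : (x : Fock n) ∈ (Submodule.span ℂ (Set.range μ.yFock))ᗮ := by
    rw [Submodule.mem_orthogonal]
    intro u hu
    induction hu using Submodule.span_induction with
    | zero => simp
    | add u v _ _ hu hv => rw [inner_add_left, hu, hv, add_zero]
    | smul a u _ hu => rw [inner_smul_left, hu, mul_zero]
    | mem u hu => obtain ⟨k, rfl⟩ := hu; exact h0 k
  rw [← Submodule.orthogonal_closure] at h1
  have h2 := (Submodule.mem_orthogonal _ _).1 h1 x x.2
  exact Subtype.ext (inner_self_eq_zero.1 h2)

/-- Tested against `y l`, the projection disappears. The weight produced by W_i cancels against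
𝛍(g_i α, g_0) = μ_{g_i α} 𝛍(α, g_0), leaving 1/𝛍(α, g_0)², and the sum over Λ_k is again ω_k. -/
theorem B_y (i : Fin n) (k : Fin n → ℕ) : μ.B i (μ.y k) = μ.y (k + Pi.single i 1) := by
  refine μ.eq_of_forall_inner_y fun l => ?_
  have h1 : ⟪μ.y l, μ.B i (μ.y k)⟫_ℂ = ⟪μ.yFock l, μ.W i (μ.yFock k)⟫_ℂ := by
    rw [B, ContinuousLinearMap.comp_apply, Submodule.inner_orthogonalProjectionOnto_eq_of_mem_left]
    rfl
  have hω : (μ.ω k : ℂ) ≠ 0 := by exact_mod_cast (μ.ω_pos k).ne'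
  have h2 : ∀ α ∈ LamFinset k, ⟪μ.yFock l, μ.W i ((1 / μ.prod α : ℂ) • e α)⟫_ℂ =
      (if l = k + Pi.single i 1 then (1 / μ.ω l : ℂ) else 0) * (1 / μ.prod α ^ 2 : ℂ) := by
    intro α hα
    have h3 : (μ.prod α : ℂ) ≠ 0 := by exact_mod_cast (μ.prod_pos α).ne'
    have h4 : (μ.toFun (i :: α) : ℂ) ≠ 0 := by exact_mod_cast (μ.pos i α).ne'
    have h5 : μ.prod (i :: α) = μ.toFun (i :: α) * μ.prod α := rfl
    rw [map_smul, W_e, inner_smul_right, inner_smul_right, inner_yFock_e, count_cons_eq,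
      mem_LamFinset.1 hα, h5]
    simp only [eq_comm (a := k + Pi.single i 1)]
    split_ifs
    · push_cast
      field_simp
    · simp
  rw [h1, inner_y_y, show μ.yFock k =
      (1 / μ.ω k : ℂ) • ∑ α ∈ LamFinset k, (1 / μ.prod α : ℂ) • e α from rfl,
    map_smul, map_sum, inner_smul_right, inner_sum, Finset.sum_congr rfl h2, ← Finset.mul_sum, sum_inv_prod_sq]
  field_simp

theorem B_pow_y (i : Fin n) (m : ℕ) (p : Fin n → ℕ) :
    (μ.B i ^ m) (μ.y p) = μ.y (p + Pi.single i m) := by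
  induction m with
  | zero => simp
  | succ m ih =>
    rw [pow_succ', mul_apply_eq_comp, ih, B_y, add_assoc, ← Pi.single_add]

theorem Bpow_y (k p : Fin n → ℕ) : μ.Bpow k (μ.y p) = μ.y (k + p) := by
  -- Generalized from the full list of generators to any list, for the induction.
  have h : ∀ L : List (Fin n), (L.map fun i => μ.B i ^ k i).prod (μ.y p) =
      μ.y ((L.map fun i => Pi.single i (k i)).sum + p) := by
    intro L
    induction L with
    | nil => simp
    | cons i L ih =>
      rw [List.map_cons, List.prod_cons, mul_apply_eq_comp, ih, B_pow_y]
      congr 1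
      rw [List.map_cons, List.sum_cons]
      abel
  rw [Bpow, h]
  congr 2
  rw [← Finset.univ_sum_single k]
  simp [List.sum_ofFn, ← List.ofFn_eq_map]

/-- The orthonormal basis `√ω_k y^{(k)}` of the symmetric weighted Fock space. -/
def basis : HilbertBasis (Fin n → ℕ) ℂ μ.symFock :=
  HilbertBasis.mkOfOrthogonalEqBot (v := fun k => ((√(μ.ω k) : ℝ) : ℂ) • μ.y k)
    (by
      rw [orthonormal_iff_ite]
      intro l k
      rw [μ.symFock_inner_smul_left, μ.symFock_inner_smul_right, inner_y_y, Complex.conj_ofReal]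
      split_ifs with h
      · subst h
        have h1 : ((√(μ.ω l) : ℝ) : ℂ) * ((√(μ.ω l) : ℝ) : ℂ) = μ.ω l := by
          exact_mod_cast Real.mul_self_sqrt (μ.ω_pos l).le
        have hω : (μ.ω l : ℂ) ≠ 0 := by exact_mod_cast (μ.ω_pos l).ne'
        rw [← mul_assoc, h1]
        field_simp
      · simp)
    (by
      refine (Submodule.eq_bot_iff _).2 fun x hx => μ.eq_of_forall_inner_y fun k => ?_
      have h1 := (Submodule.mem_orthogonal _ _).1 hx _ (Submodule.subset_span ⟨k, rfl⟩)
      rw [μ.symFock_inner_smul_left, Complex.conj_ofReal] at h1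
      rw [inner_zero_right]
      refine (mul_eq_zero.1 h1).resolve_left ?_
      exact_mod_cast (Real.sqrt_pos.2 (μ.ω_pos k)).ne')

theorem sqrt_ω_ne_zero (k : Fin n → ℕ) : ((√(μ.ω k) : ℝ) : ℂ) ≠ 0 := by
  exact_mod_cast (Real.sqrt_pos.2 (μ.ω_pos k)).ne'

theorem basis_apply (k : Fin n → ℕ) : μ.basis k = ((√(μ.ω k) : ℝ) : ℂ) • μ.y k := by
  simp [basis]

theorem dense_span_y : Dense (Submodule.span ℂ (Set.range μ.y) : Set μ.symFock) := by
  have h := Submodule.dense_iff_topologicalClosure_eq_top.2 μ.basis.dense_span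
  refine h.mono (Submodule.span_le.2 ?_)
  rintro _ ⟨k, rfl⟩
  rw [basis_apply]
  exact Submodule.smul_mem _ _ (Submodule.subset_span ⟨k, rfl⟩)

/-! ### Coefficients and Cesàro means -/

theorem existsUnique_hasSum_y (f : μ.symFock) :
    ∃! c : (Fin n → ℕ) → ℂ, HasSum (fun k => c k • μ.y k) f := by
  -- The factor √ω_k converts coordinates in the orthonormal basis √ω_k y k into coefficients of y
  -- k; uniqueness comes from pairing with a basis vector.
  refine ⟨fun k => μ.basis.repr f k * (√(μ.ω k) : ℝ), ?_, fun c hc => ?_⟩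
  · have := μ.basis.hasSum_repr f
    simpa only [basis_apply, smul_smul] using this
  · ext k
    have h1 := hc.mapL (innerSL ℂ (μ.basis k))
    have h2 := h1.unique (hasSum_single k fun l hl => ?_)
    · rw [μ.basis.repr_apply_apply]
      rw [innerSL_apply_apply] at h2
      rw [h2, basis_apply, innerSL_apply_apply, μ.symFock_inner_smul_left, μ.symFock_inner_smul_right, inner_y_y,
        if_pos rfl, Complex.conj_ofReal]
      have h3 : ((√(μ.ω k) : ℝ) : ℂ) * ((√(μ.ω k) : ℝ) : ℂ) = μ.ω k := by
        exact_mod_cast Real.mul_self_sqrt (μ.ω_pos k).le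
      have hω : (μ.ω k : ℂ) ≠ 0 := by exact_mod_cast (μ.ω_pos k).ne'
      field_simp
      linear_combination (-c k) * h3
    · rw [basis_apply, innerSL_apply_apply, μ.symFock_inner_smul_left, μ.symFock_inner_smul_right, inner_y_y,
        if_neg hl.symm]
      simp

theorem finite_degree_le (m : ℕ) : {k : Fin n → ℕ | ∑ i, k i ≤ m}.Finite := by
  refine (Set.finite_Iic (fun _ : Fin n => m)).subset fun k hk i => ?_
  exact (Finset.single_le_sum (fun _ _ => Nat.zero_le _) (Finset.mem_univ i)).trans hk

/-- Since B^k raises degree by |k|, the Cesàro coefficient is the Fejér weight between the degrees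
of p and k + p. It vanishes for |k| > N, so the finite sum becomes a series comparable term by term
with that of A. -/
theorem cesaro_apply (c : (Fin n → ℕ) → ℂ) (N : ℕ) (p : Fin n → ℕ) :
    HasSum (fun k => (fejerWeight N (∑ i, p i) (∑ i, (k + p) i) * c k : ℂ) • μ.y (k + p))
      (μ.cesaro c N (μ.y p)) := by
  have h1 : μ.cesaro c N (μ.y p) = ∑ k ∈ (Fintype.piFinset fun _ : Fin n =>
      Finset.range (N + 1)) with ∑ i, k i ≤ N,
      (fejerWeight N (∑ i, p i) (∑ i, (k + p) i) * c k : ℂ) • μ.y (k + p) := by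
    rw [cesaro, sum_apply]
    refine Finset.sum_congr rfl fun k hk => ?_
    rw [smul_apply, Bpow_y]
    simp only [Pi.add_apply, Finset.sum_add_distrib, fejerWeight_add]
    rw [if_pos (Finset.mem_filter.1 hk).2]
  rw [h1]
  refine hasSum_sum_of_ne_finset_zero fun k hk => ?_
  have hk' : ¬ ∑ i, k i ≤ N := by
    refine fun h => hk (Finset.mem_filter.2 ⟨Fintype.mem_piFinset.2 fun i => ?_, h⟩)
    have := (Finset.single_le_sum (f := k) (fun _ _ => Nat.zero_le _) (Finset.mem_univ i)).trans h
    exact Finset.mem_range.2 (by omega)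
  simp only [Pi.add_apply, Finset.sum_add_distrib, fejerWeight_add, if_neg hk']
  simp

/-- Pairing with `y q` leaves at most the term k + p = q, whose weight depends only on the degrees
of p and q. -/
theorem inner_basis_cesaro {A : μ.symFock →L[ℂ] μ.symFock} {c : (Fin n → ℕ) → ℂ}
    (hA : ∀ p, HasSum (fun k => c k • μ.Bpow k (μ.y p)) (A (μ.y p))) (N : ℕ) (p q : Fin n → ℕ) :
    ⟪μ.basis q, μ.cesaro c N (μ.basis p)⟫_ℂ =
      fejerWeight N (∑ i, p i) (∑ i, q i) * ⟪μ.basis q, A (μ.basis p)⟫_ℂ := by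
  simp only [basis_apply, map_smul, μ.symFock_inner_smul_left, μ.symFock_inner_smul_right]
  have h1 := (μ.cesaro_apply c N p).mapL (innerSL ℂ (μ.y q))
  have h2 := ((hA p).mapL (innerSL ℂ (μ.y q))).mul_left
    (fejerWeight N (∑ i, p i) (∑ i, q i) : ℂ)
  have h3 : ⟪μ.y q, μ.cesaro c N (μ.y p)⟫_ℂ =
      fejerWeight N (∑ i, p i) (∑ i, q i) * ⟪μ.y q, A (μ.y p)⟫_ℂ := by
    refine h1.unique (Eq.mpr (congrArg (HasSum · _) (funext fun k => ?_)) h2)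
    simp only [innerSL_apply_apply, μ.symFock_inner_smul_right, Bpow_y, inner_y_y]
    split_ifs with h
    · rw [h, mul_assoc]
    · simp
  rw [h3]
  ring

end WeightSequence

namespace WeightSequence

variable {n : ℕ} (μ : WeightSequence n) (hD : μ.domain ∈ 𝓝 (0 : Fin n → ℂ))

/-! ### The identification of the symmetric Fock space with the Hardy space -/

/-- The unitary operator from the symmetric weighted Fock space onto `H²(D(𝛍))` that maps
`y^{(k)}` to the monomial `λ^k`. -/
def toHardy : μ.symFock ≃ₗᵢ[ℂ] μ.HardySpace hD :=
  μ.basis.repr.trans (LinearIsometryEquiv.mk HardySpace.equivLp fun _ => rfl :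
    μ.HardySpace hD ≃ₗᵢ[ℂ] lp (fun _ : Fin n → ℕ => ℂ) 2).symm

theorem toHardy_y (k : Fin n → ℕ) (z : μ.domain) :
    μ.toHardy hD (μ.y k) z = monomial z.1 k := by
  classical
  have h1 : HardySpace.equivLp (μ.toHardy hD (μ.y k)) = μ.basis.repr (μ.y k) :=
    LinearEquiv.apply_symm_apply _ _
  have h2 : HardySpace.coeff (μ.toHardy hD (μ.y k)) = Pi.single k 1 := by
    ext l
    have h3 : HardySpace.coeff (μ.toHardy hD (μ.y k)) l / (√(μ.ω l) : ℝ) =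
        μ.basis.repr (μ.y k) l :=
      congrArg (fun v : lp (fun _ : Fin n → ℕ => ℂ) 2 => v l) h1
    rw [div_eq_iff (μ.sqrt_ω_ne_zero l)] at h3
    -- The normalized coefficient is √ω_l ⟨y l, y k⟩; multiplying by √ω_l turns it into 1 for l = k
    -- and 0 otherwise.
    rw [h3, μ.basis.repr_apply_apply, basis_apply, symFock_inner_smul_left, inner_y_y,
      Complex.conj_ofReal, Pi.single_apply]
    split_ifs with h
    · have h4 : ((√(μ.ω l) : ℝ) : ℂ) * ((√(μ.ω l) : ℝ) : ℂ) = μ.ω l := by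
        exact_mod_cast Real.mul_self_sqrt (μ.ω_pos l).le
      have hω : (μ.ω l : ℂ) ≠ 0 := by exact_mod_cast (μ.ω_pos l).ne'
      field_simp
      linear_combination h4
    · simp
  have h5 := (HardySpace.coeff_spec (μ.toHardy hD (μ.y k))).2 z
  rw [h2] at h5
  have h6 := h5.unique (hasSum_single k fun l hl => by simp [hl])
  rw [Pi.single_eq_same, one_mul] at h6
  exact h6

/-- Evaluation at a point of the domain, as a functional on the symmetric weighted Fock space. -/
def evalSymFock (z : μ.domain) : μ.symFock →L[ℂ] ℂ :=
  ContinuousLinearMap.proj (R := ℂ) (φ := fun _ : μ.domain => ℂ) z ∘L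
    RKHS.coeCLM ℂ ∘L (μ.toHardy hD).toContinuousLinearEquiv.toContinuousLinearMap

theorem evalSymFock_apply (z : μ.domain) (f : μ.symFock) :
    μ.evalSymFock hD z f = μ.toHardy hD f z := rfl

theorem evalSymFock_y (z : μ.domain) (k : Fin n → ℕ) :
    μ.evalSymFock hD z (μ.y k) = monomial z.1 k :=
  μ.toHardy_y hD k z

theorem ext_evalSymFock {f g : μ.symFock}
    (h : ∀ z, μ.evalSymFock hD z f = μ.evalSymFock hD z g) : f = g :=
  (μ.toHardy hD).injective (RKHS.ext h)

theorem monomial_zero (z : Fin n → ℂ) : monomial z 0 = 1 := by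
  simp [monomial]

theorem monomial_add_single (z : Fin n → ℂ) (k : Fin n → ℕ) (i : Fin n) :
    monomial z (k + Pi.single i 1) = z i * monomial z k := by
  simp only [monomial, Pi.add_apply, pow_add, Finset.prod_mul_distrib]
  rw [mul_comm, Finset.prod_eq_single i (f := fun j => z j ^ (Pi.single i 1 : Fin n → ℕ) j)]
  · simp
  · intro j _ hj
    simp [hj]
  · simp

/-- Both sides are continuous in f and agree on the total set of the y's, where B_i is the shift. -/
theorem evalSymFock_B (z : μ.domain) (i : Fin n) (f : μ.symFock) :
    μ.evalSymFock hD z (μ.B i f) = z.1 i * μ.evalSymFock hD z f := by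
  have h : μ.evalSymFock hD z ∘L μ.B i = z.1 i • μ.evalSymFock hD z := by
    refine ContinuousLinearMap.ext_on μ.dense_span_y ?_
    rintro _ ⟨k, rfl⟩
    rw [ContinuousLinearMap.comp_apply, B_y, evalSymFock_y, smul_apply, evalSymFock_y,
      monomial_add_single, smul_eq_mul]
  exact congrArg (fun T => T f) h

/-! ### The operators that act as multiplications -/

/-- The operators which become multiplications by functions on `H²(D(𝛍))`. -/
def multiplicationAlgebra : Subalgebra ℂ (μ.symFock →L[ℂ] μ.symFock) where
  carrier := {A | ∀ f z,
    μ.evalSymFock hD z (A f) = μ.evalSymFock hD z (A (μ.y 0)) * μ.evalSymFock hD z f}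
  mul_mem' := by
    intro A A' hA hA' f z
    -- Applying `hA` to A' 1 as well shows that the symbol of the product is the product of the
    -- symbols.
    rw [mul_apply_eq_comp, mul_apply_eq_comp, hA, hA', hA (A' (μ.y 0)), mul_assoc]
  add_mem' := by
    intro A A' hA hA' f z
    rw [add_apply, add_apply, map_add, map_add, hA, hA', add_mul]
  algebraMap_mem' := by
    intro a f z
    rw [Algebra.algebraMap_eq_smul_one, smul_apply, smul_apply, map_smul, map_smul,
      one_apply_eq_self, one_apply_eq_self, evalSymFock_y, monomial_zero, smul_eq_mul,
      smul_eq_mul, mul_one]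

theorem mem_multiplicationAlgebra {A : μ.symFock →L[ℂ] μ.symFock} :
    A ∈ μ.multiplicationAlgebra hD ↔ ∀ f z,
      μ.evalSymFock hD z (A f) = μ.evalSymFock hD z (A (μ.y 0)) * μ.evalSymFock hD z f :=
  Iff.rfl

theorem B_mem_multiplicationAlgebra (i : Fin n) : μ.B i ∈ μ.multiplicationAlgebra hD := by
  intro f z
  rw [evalSymFock_B, evalSymFock_B, evalSymFock_y, monomial_zero, mul_one]

theorem isClosed_multiplicationAlgebra : IsClosed[ultraweakTopology μ.symFock]
    (μ.multiplicationAlgebra hD : Set (μ.symFock →L[ℂ] μ.symFock)) := by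
  have hc : ∀ (z : μ.domain) (f : μ.symFock), Continuous[ultraweakTopology μ.symFock, inferInstance]
      fun A : μ.symFock →L[ℂ] μ.symFock => μ.evalSymFock hD z (A f) := by
    intro z f
    -- Riesz: evaluation at z is the inner product with a vector, the kernel function at z pulled
    -- back by U.
    have := continuous_ultraweakTopology_inner f
      ((InnerProductSpace.toDual ℂ μ.symFock).symm (μ.evalSymFock hD z))
    simpa only [InnerProductSpace.toDual_symm_apply] using this
  have h : (μ.multiplicationAlgebra hD : Set (μ.symFock →L[ℂ] μ.symFock)) = ⋂ (f) (z), {A |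
      μ.evalSymFock hD z (A f) = μ.evalSymFock hD z (A (μ.y 0)) * μ.evalSymFock hD z f} := by
    ext A
    simp [mem_multiplicationAlgebra]
  rw [h]
  refine @isClosed_iInter _ _ (ultraweakTopology _) _ fun f =>
    @isClosed_iInter _ _ (ultraweakTopology _) _ fun z => ?_
  exact @isClosed_eq _ _ _ (ultraweakTopology _) _ _ _ (hc z f)
    (@Continuous.comp _ _ _ (ultraweakTopology _) _ _ _ _
      (continuous_mul_const (μ.evalSymFock hD z f)) (hc z (μ.y 0)))

theorem hardyAlgebra_le_multiplicationAlgebra :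
    μ.hardyAlgebra ≤ μ.multiplicationAlgebra hD :=
  sInf_le ⟨μ.B_mem_multiplicationAlgebra hD, μ.isClosed_multiplicationAlgebra hD⟩

theorem Bpow_mem {S : Subalgebra ℂ (μ.symFock →L[ℂ] μ.symFock)} (hS : ∀ i, μ.B i ∈ S)
    (k : Fin n → ℕ) : μ.Bpow k ∈ S := by
  refine list_prod_mem fun T hT => ?_
  obtain ⟨i, _, rfl⟩ := List.mem_map.1 hT
  exact pow_mem (hS i) _

theorem cesaro_mem {S : Subalgebra ℂ (μ.symFock →L[ℂ] μ.symFock)} (hS : ∀ i, μ.B i ∈ S)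
    (c : (Fin n → ℕ) → ℂ) (N : ℕ) : μ.cesaro c N ∈ S :=
  sum_mem fun k _ => S.smul_mem (μ.Bpow_mem hS k) _

/-! ### Commutation and Fourier series of multiplications -/

variable {hD} {μ}

theorem apply_comm_of_mem {A A' : μ.symFock →L[ℂ] μ.symFock}
    (hA : A ∈ μ.multiplicationAlgebra hD) (hA' : A' ∈ μ.multiplicationAlgebra hD)
    (f : μ.symFock) : A (A' f) = A' (A f) := by
  refine μ.ext_evalSymFock hD fun z => ?_
  rw [hA, hA' f, hA' (A f), hA f]
  ring

theorem eq_of_apply_y_zero_eq {A A' : μ.symFock →L[ℂ] μ.symFock}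
    (hA : A ∈ μ.multiplicationAlgebra hD) (hA' : A' ∈ μ.multiplicationAlgebra hD)
    (h : A (μ.y 0) = A' (μ.y 0)) : A = A' := by
  ext1 f
  refine μ.ext_evalSymFock hD fun z => ?_
  rw [hA, hA', h]

/-- A commutes with B^p and y p = B^p 1, so applying the bounded operator B^p to the expansion of A
1 yields that of A (y p). -/
theorem IsFourierRepresentation.hasSum_apply_y {A : μ.symFock →L[ℂ] μ.symFock}
    (hA : A ∈ μ.multiplicationAlgebra hD) {c : (Fin n → ℕ) → ℂ}
    (hc : μ.IsFourierRepresentation A c) (p : Fin n → ℕ) :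
    HasSum (fun k => c k • μ.Bpow k (μ.y p)) (A (μ.y p)) := by
  have hp := μ.Bpow_mem (μ.B_mem_multiplicationAlgebra hD) p
  have h : μ.y p = μ.Bpow p (μ.y 0) := by rw [Bpow_y, add_zero]
  have h1 := hc.mapL (μ.Bpow p)
  rw [← apply_comm_of_mem hA hp, ← h] at h1
  simpa only [map_smul, Bpow_y, add_comm] using h1

theorem IsFourierRepresentation.norm_cesaro_le {A : μ.symFock →L[ℂ] μ.symFock}
    (hA : A ∈ μ.multiplicationAlgebra hD) {c : (Fin n → ℕ) → ℂ}
    (hc : μ.IsFourierRepresentation A c) (N : ℕ) : ‖μ.cesaro c N‖ ≤ ‖A‖ :=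
  norm_le_of_fejerWeight μ.basis finite_degree_le
    fun p q => μ.inner_basis_cesaro (hc.hasSum_apply_y hA) N p q

theorem IsFourierRepresentation.tendsto_cesaro {A : μ.symFock →L[ℂ] μ.symFock}
    (hA : A ∈ μ.multiplicationAlgebra hD) {c : (Fin n → ℕ) → ℂ}
    (hc : μ.IsFourierRepresentation A c) (f : μ.symFock) :
    Filter.Tendsto (fun N => μ.cesaro c N f) Filter.atTop (𝓝 (A f)) :=
  tendsto_of_fejerWeight μ.basis finite_degree_le
    (fun N p q => μ.inner_basis_cesaro (hc.hasSum_apply_y hA) N p q) f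

variable (hD) (μ)

/-- The Cesàro means of A are polynomials in the B_i, so they lie in every w*-closed algebra S of
the defining infimum; being bounded by ‖A‖ and strongly convergent, they carry A into S. -/
theorem multiplicationAlgebra_le_hardyAlgebra :
    μ.multiplicationAlgebra hD ≤ μ.hardyAlgebra := by
  intro A hA
  obtain ⟨c, hc, -⟩ := μ.existsUnique_hasSum_y (A (μ.y 0))
  have hc' : μ.IsFourierRepresentation A c := hc
  refine Algebra.mem_sInf.2 fun S hS => ?_
  exact @IsClosed.mem_of_tendsto _ (ultraweakTopology _) _ _ _ _ _ _ hS.2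
    (tendsto_ultraweakTopology (hc'.norm_cesaro_le hA) (hc'.tendsto_cesaro hA))
    (Filter.Eventually.of_forall fun N => μ.cesaro_mem hS.1 c N)

/-! ### The isomorphism onto the multiplier algebra -/

variable {μ} in
theorem evalSymFock_apply_of_mem_hardyAlgebra {A : μ.symFock →L[ℂ] μ.symFock}
    (hA : A ∈ μ.hardyAlgebra) (f : μ.symFock) (z : μ.domain) :
    μ.evalSymFock hD z (A f) = μ.evalSymFock hD z (A (μ.y 0)) * μ.evalSymFock hD z f :=
  μ.hardyAlgebra_le_multiplicationAlgebra hD hA f z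

/-- The multiplier `λ ↦ (U A 1)(λ)` of an element `A` of the Hardy algebra. -/
def symbolHom : μ.hardyAlgebra →ₐ[ℂ] multiplierAlgebra (μ.HardySpace hD) where
  toFun A := ⟨fun z => μ.evalSymFock hD z ((A : μ.symFock →L[ℂ] μ.symFock) (μ.y 0)), fun f =>
    ⟨μ.toHardy hD ((A : μ.symFock →L[ℂ] μ.symFock) ((μ.toHardy hD).symm f)), fun z => by
      have h := evalSymFock_apply_of_mem_hardyAlgebra hD A.2 ((μ.toHardy hD).symm f) z
      rwa [evalSymFock_apply, evalSymFock_apply _ _ _ ((μ.toHardy hD).symm f),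
        LinearIsometryEquiv.apply_symm_apply] at h⟩⟩
  map_one' := Subtype.ext <| funext fun z => by
    change μ.evalSymFock hD z (μ.y 0) = 1
    rw [evalSymFock_y, monomial_zero]
  map_mul' A A' := Subtype.ext <| funext fun z =>
    evalSymFock_apply_of_mem_hardyAlgebra hD A.2 _ z
  map_zero' := Subtype.ext <| funext fun z => map_zero (μ.evalSymFock hD z)
  map_add' A A' := Subtype.ext <| funext fun z => map_add (μ.evalSymFock hD z) _ _
  commutes' a := Subtype.ext <| funext fun z => by
    change μ.evalSymFock hD z (a • μ.y 0) = a
    rw [map_smul, evalSymFock_y, monomial_zero, smul_eq_mul, mul_one]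

theorem symbolHom_apply (A : μ.hardyAlgebra) (z : μ.domain) :
    (μ.symbolHom hD A : μ.domain → ℂ) z =
      μ.evalSymFock hD z ((A : μ.symFock →L[ℂ] μ.symFock) (μ.y 0)) := rfl

theorem toHardy_apply_eq_mulOperator (A : μ.hardyAlgebra) (f : μ.symFock) :
    μ.toHardy hD ((A : μ.symFock →L[ℂ] μ.symFock) f) =
      mulOperator (μ.symbolHom hD A) (μ.toHardy hD f) := by
  refine RKHS.ext fun z => ?_
  rw [mulOperator_apply]
  exact evalSymFock_apply_of_mem_hardyAlgebra hD A.2 f z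

theorem symbolHom_injective : Function.Injective (μ.symbolHom hD) := by
  intro A A' h
  refine Subtype.ext (eq_of_apply_y_zero_eq (hD := hD)
    (μ.hardyAlgebra_le_multiplicationAlgebra hD A.2)
    (μ.hardyAlgebra_le_multiplicationAlgebra hD A'.2) (μ.ext_evalSymFock hD fun z => ?_))
  rw [← symbolHom_apply, ← symbolHom_apply, h]

/-- Conjugating the bounded operator M_φ by U gives a multiplication with symbol φ, because U 1 is
the constant 1; the reverse inclusion places it in the Hardy algebra. -/
theorem symbolHom_surjective : Function.Surjective (μ.symbolHom hD) := by
  intro φ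
  let A : μ.symFock →L[ℂ] μ.symFock :=
    (μ.toHardy hD).symm.toContinuousLinearEquiv.toContinuousLinearMap ∘L mulOperator φ ∘L
      (μ.toHardy hD).toContinuousLinearEquiv.toContinuousLinearMap
  have hA : ∀ f z, μ.evalSymFock hD z (A f) = (φ : μ.domain → ℂ) z * μ.evalSymFock hD z f := by
    intro f z
    have h : μ.toHardy hD (A f) = mulOperator φ (μ.toHardy hD f) :=
      (μ.toHardy hD).apply_symm_apply _
    rw [evalSymFock_apply, h, mulOperator_apply, evalSymFock_apply]
  have hA0 : ∀ z, μ.evalSymFock hD z (A (μ.y 0)) = (φ : μ.domain → ℂ) z := by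
    intro z
    rw [hA, evalSymFock_y, monomial_zero, mul_one]
  refine ⟨⟨A, μ.multiplicationAlgebra_le_hardyAlgebra hD fun f z => ?_⟩,
    Subtype.ext (funext hA0)⟩
  rw [hA0, hA]

/-- The Hardy algebra is isomorphic to the multiplier algebra. -/
def symbolEquiv : μ.hardyAlgebra ≃ₐ[ℂ] multiplierAlgebra (μ.HardySpace hD) :=
  AlgEquiv.ofBijective (μ.symbolHom hD) ⟨μ.symbolHom_injective hD, μ.symbolHom_surjective hD⟩

theorem norm_mulOperator_symbolHom (A : μ.hardyAlgebra) :
    ‖mulOperator (μ.symbolHom hD A)‖ = ‖(A : μ.symFock →L[ℂ] μ.symFock)‖ := by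
  refine le_antisymm ?_ ?_
  · refine ContinuousLinearMap.opNorm_le_bound _
      (norm_nonneg (A : μ.symFock →L[ℂ] μ.symFock)) fun f => ?_
    have h := μ.toHardy_apply_eq_mulOperator hD A ((μ.toHardy hD).symm f)
    rw [LinearIsometryEquiv.apply_symm_apply] at h
    rw [← h, LinearIsometryEquiv.norm_map, ← (μ.toHardy hD).symm.norm_map f]
    exact ContinuousLinearMap.le_opNorm _ _
  · refine ContinuousLinearMap.opNorm_le_bound _ (norm_nonneg _) fun f => ?_
    rw [← (μ.toHardy hD).norm_map, toHardy_apply_eq_mulOperator, ← (μ.toHardy hD).norm_map f]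
    exact ContinuousLinearMap.le_opNorm _ _

end WeightSequence

end WeightedFock

end

open WeightedFock in
theorem theorem6p3 {n : ℕ} (μ : WeightSequence n) (hD : μ.domain ∈ 𝓝 (0 : Fin n → ℂ)) :
    ∃ (U : μ.symFock ≃ₗᵢ[ℂ] μ.HardySpace hD)
      (Ψ : μ.hardyAlgebra ≃ₐ[ℂ] multiplierAlgebra (μ.HardySpace hD)),
      -- `U` is the unitary operator with `U y^{(k)} = λ^k`
      (∀ (k : Fin n → ℕ) (z : μ.domain), U (μ.y k) z = monomial z.1 k) ∧
      -- under `U`, each `A` in the Hardy algebra becomes multiplication by `Ψ A`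
      (∀ (A : μ.hardyAlgebra) (f : μ.symFock),
        U ((A : μ.symFock →L[ℂ] μ.symFock) f) = mulOperator (Ψ A) (U f)) ∧
      -- the identification is isometric for the multiplier norm
      (∀ A : μ.hardyAlgebra, ‖mulOperator (Ψ A)‖ = ‖(A : μ.symFock →L[ℂ] μ.symFock)‖) ∧
      -- `B_i` corresponds to the coordinate function `λ_i`
      (∀ (i : Fin n) (z : μ.domain), (Ψ ⟨μ.B i, μ.B_mem i⟩ : μ.domain → ℂ) z = z.1 i) ∧
      -- every element has exactly one Fourier representation
      (∀ A : μ.hardyAlgebra,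
        ∃! c : (Fin n → ℕ) → ℂ, μ.IsFourierRepresentation A c) ∧
      -- an element is determined by its Fourier representation
      (∀ (A A' : μ.hardyAlgebra) (c : (Fin n → ℕ) → ℂ),
        μ.IsFourierRepresentation A c → μ.IsFourierRepresentation A' c → A = A') ∧
      -- the Fourier representation of `A`
      (∀ (A : μ.hardyAlgebra) (c : (Fin n → ℕ) → ℂ), μ.IsFourierRepresentation A c →
        -- acts as `A` on the vectors `y^{(p)}`
        (∀ p : Fin n → ℕ, HasSum (fun k => c k • μ.Bpow k (μ.y p))
          ((A : μ.symFock →L[ℂ] μ.symFock) (μ.y p))) ∧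
        -- is the power series of the multiplier `Ψ A`
        (∀ z : μ.domain, HasSum (fun k => c k * monomial z.1 k)
          ((Ψ A : μ.domain → ℂ) z)) ∧
        -- and its Cesaro means converge to `A` in the strong operator topology
        (∀ f : μ.symFock, Filter.Tendsto (fun N => μ.cesaro c N f) Filter.atTop
          (𝓝 ((A : μ.symFock →L[ℂ] μ.symFock) f)))) := by
  have hmem : ∀ A : μ.hardyAlgebra,
      (A : μ.symFock →L[ℂ] μ.symFock) ∈ μ.multiplicationAlgebra hD :=
    fun A => μ.hardyAlgebra_le_multiplicationAlgebra hD A.2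
  refine ⟨μ.toHardy hD, μ.symbolEquiv hD, μ.toHardy_y hD, μ.toHardy_apply_eq_mulOperator hD,
    μ.norm_mulOperator_symbolHom hD, fun i z => ?_, fun A => μ.existsUnique_hasSum_y _,
    fun A A' c hc hc' => Subtype.ext
      (WeightSequence.eq_of_apply_y_zero_eq (hmem A) (hmem A') (hc.unique hc')),
    fun A c hc => ⟨hc.hasSum_apply_y (hmem A), fun z => ?_, hc.tendsto_cesaro (hmem A)⟩⟩
  · have h := μ.evalSymFock_B hD z i (μ.y 0)
    rwa [WeightSequence.evalSymFock_y, WeightSequence.monomial_zero, mul_one] at h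
  -- Evaluation at z is continuous, so it passes through the series of A 1, whose value at z is the
  -- symbol of A.
  · have h := ContinuousLinearMap.hasSum (μ.evalSymFock hD z) hc
    simp only [map_smul, WeightSequence.evalSymFock_y, smul_eq_mul] at h
    exact h
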